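/- Let $\mathbb{G}$ be a simplicial groupoid, i.e. a groupoid object in the category of simplicial sets, with simplicial sets ${\rm ob}(\mathbb{G})$ of objects and ${\rm ar}(\mathbb{G})$ of arrows and with source and target maps $s,t\colon {\rm ar}(\mathbb{G})\to{\rm ob}(\mathbb{G})$. Its nerve $N\mathbb{G}$ is a bisimplicial set: $(N\mathbb{G})_{p,q}$ is the set of strings of $p$ composable arrows in the groupoid $\mathbb{G}_q$ of $q$-simplices. Let $B\mathbb{G}$ be the diagonal of $N\mathbb{G}$, so $(B\mathbb{G})_n=(N\mathbb{G})_{n,n}$. If $\mathbb{G}$ acts from the left on a map $\pi\colon X\to{\rm ob}(\mathbb{G})$ of simplicial sets, let $X_{\mathbb{G}}$ be the action groupoid, with ${\rm ob}(X_{\mathbb{G}})=X$ and ${\rm ar}(X_{\mathbb{G}})={\rm ar}(\mathbb{G})\times_{{\rm ob}(\mathbb{G})}X$, where $(g,x)$ is an arrow from $x$ to $g\cdot x$; it comes with the projection $X_{\mathbb{G}}\to\mathbb{G}$. (i) If ${\rm ob}(\mathbb{G})$ is a Kan complex and $s\colon{\rm ar}(\mathbb{G})\to{\rm ob}(\mathbb{G})$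 is a Kan fibration, then $B\mathbb{G}$ is a Kan complex. (ii) If $\mathbb{G}$ acts from the left on $\pi\colon X\to{\rm ob}(\mathbb{G})$ and $\pi$ is a Kan fibration, then the induced map $B(X_{\mathbb{G}})\to B\mathbb{G}$ is a Kan fibration. (iii) If $(s,t)\colon{\rm ar}(\mathbb{G})\to{\rm ob}(\mathbb{G})\times{\rm ob}(\mathbb{G})$ is surjective (in every simplicial degree), then it is a Kan fibration. (iv) If $(s,t)\colon{\rm ar}(\mathbb{G})\to{\rm ob}(\mathbb{G})\times{\rm ob}(\mathbb{G})$ is a Kan fibration, then for every vertex $c$ of ${\rm ob}(\mathbb{G})$ there is a natural weak equivalence $\mathbb{G}(c,c)\to\Omega(B\mathbb{G},c)$, where $\mathbb{G}(c,c)\subseteq{\rm ar}(\mathbb{G})$ is the simplicial set of arrows from $c$ to $c$. Precisely: for a simplicial set $Y$ with vertex $y$ let $\Omega(Y,y)\subseteq Y^{\Delta[1]}$ be the simplicial set of paths in $Y$ that start and end at $y$. Let $\lambda_c\colon\mathbb{G}(c,c)\to\Omega(B\mathbb{G},c)$ be the map adjoint to the map $\Delta[1]\times\mathbb{G}(c,c)\to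 B\mathbb{G}$ that sends an $n$-simplex $(\alpha\colon[n]\to[1],\,f\colon c\to c)$ to the string $[n]\xrightarrow{\alpha}[1]\xrightarrow{f}\mathbb{G}_n$. Then $\lambda_c$ is a weak equivalence if $B\mathbb{G}$ is a Kan complex. In general, $B\mathbb{G}$ admits a weak equivalence to a Kan complex, and for every weak equivalence $j\colon B\mathbb{G}\to K$ to a Kan complex $K$ the composite $$\mathbb{G}(c,c)\xrightarrow{\lambda_c}\Omega(B\mathbb{G},c)\xrightarrow{\Omega(j)}\Omega(K,j(c))$$ is a weak equivalence. These maps are natural (without any condition on $(s,t)$): for all simplicial groupoids $\mathbb{G},\mathbb{G}'$, every morphism $F\colon\mathbb{G}\to\mathbb{G}'$, every vertex $c$ of ${\rm ob}(\mathbb{G})$, and all maps of simplicial sets $j\colon B\mathbb{G}\to K$, $j'\colon B\mathbb{G}'\to K'$ and $k\colon K\to K'$ with $k\circ j=j'\circ BF$, one has $$\Omega(k)\circ\Omega(j)\circ\lambda_c=\Omega(j')\circ\lambda_{F(c)}\circ F\colon\ \mathbb{G}(c,c)\to\Omega(K',j'(F(c))).$$ -/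

import Mathlib

open CategoryTheory MonoidalCategory CartesianMonoidalCategory Simplicial Opposite
open HomotopicalAlgebra
open scoped SSet.modelCategoryQuillen

universe u

noncomputable section

namespace SimplicialGroupoids

/-! ### Fibre products, diagonals, weak equivalences, loop spaces -/

/-- The fibre product `X ×_Z Y` of simplicial sets. -/
@[simps]
def fiberProd {X Y Z : SSet.{u}} (f : X ⟶ Z) (g : Y ⟶ Z) : SSet.{u} where
  obj n := {p : X.obj n × Y.obj n // f.app n p.1 = g.app n p.2}
  map φ := ↾fun p ↦ ⟨(X.map φ p.1.1, Y.map φ p.1.2), by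
    rw [NatTrans.naturality_apply, NatTrans.naturality_apply, p.2]⟩
  map_id n := by
    ext p
    · exact Functor.map_id_apply X n p.1.1
    · exact Functor.map_id_apply Y n p.1.2
  map_comp φ ψ := by
    ext p
    · exact Functor.map_comp_apply X φ ψ p.1.1
    · exact Functor.map_comp_apply Y φ ψ p.1.2

/-- The first projection `X ×_Z Y ⟶ X`. -/
@[simps]
def fiberProd.fst {X Y Z : SSet.{u}} (f : X ⟶ Z) (g : Y ⟶ Z) : fiberProd f g ⟶ X where
  app n := ↾fun p ↦ p.1.1

/-- The second projection `X ×_Z Y ⟶ Y`. -/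
@[simps]
def fiberProd.snd {X Y Z : SSet.{u}} (f : X ⟶ Z) (g : Y ⟶ Z) : fiberProd f g ⟶ Y where
  app n := ↾fun p ↦ p.1.2

/-- The diagonal `δ^* Y` of a bisimplicial set `Y`: its `n`-simplices are `Y_{n,n}`. -/
@[simps]
def diag (Y : SimplexCategoryᵒᵖ ⥤ SSet.{u}) : SSet.{u} where
  obj n := (Y.obj n).obj n
  map {n m} φ := (Y.map φ).app n ≫ (Y.obj m).map φ
  map_id n := by simp
  map_comp φ ψ := by simp

/-- The diagonal of a map of bisimplicial sets. -/
@[simps]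
def diagMap {Y Y' : SimplexCategoryᵒᵖ ⥤ SSet.{u}} (α : Y ⟶ Y') : diag Y ⟶ diag Y' where
  app n := (α.app n).app n
  naturality n m φ := by
    ext y
    have h := ConcreteCategory.congr_hom (congr_app (α.naturality φ) n) y
    refine (NatTrans.naturality_apply (α.app m) φ ((Y.map φ).app n y)).trans ?_
    exact congrArg ((Y'.obj m).map φ) h

/-- The set `[X, Z]` of homotopy classes of maps of simplicial sets. -/
def HomotopyClasses (X Z : SSet.{u}) : Type u :=
  Quot fun f g : X ⟶ Z ↦ Nonempty (SSet.Homotopy f g)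

/-- Precomposition `[Y, Z] → [X, Z]` with a map `f : X ⟶ Y`. -/
def HomotopyClasses.precomp {X Y : SSet.{u}} (f : X ⟶ Y) (Z : SSet.{u}) :
    HomotopyClasses Y Z → HomotopyClasses X Z :=
  Quot.map (fun h ↦ f ≫ h) (by
    rintro a b ⟨H⟩
    exact ⟨{ h := f ▷ _ ≫ H.h
             h₀ := by rw [SSet.ι₀_comp_assoc, H.h₀]; rfl
             h₁ := by rw [SSet.ι₁_comp_assoc, H.h₁]; rfl
             rel := by
              ext n ⟨⟨x, hx⟩, y⟩
              exact hx.elim }⟩)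

/-- A map `f : X ⟶ Y` of simplicial sets is a (Kan–Quillen) weak equivalence if it induces
bijections `[Y, Z] ≃ [X, Z]` for all Kan complexes `Z`. -/
def IsWeakEquiv {X Y : SSet.{u}} (f : X ⟶ Y) : Prop :=
  ∀ (Z : SSet.{u}) [SSet.KanComplex Z], Function.Bijective (HomotopyClasses.precomp f Z)

/-- The fibre of `p : X ⟶ Y` over the vertex `y`. -/
def fiber {X Y : SSet.{u}} (p : X ⟶ Y) (y : Y _⦋0⦌) : X.Subcomplex :=
  (SSet.Subcomplex.ofSimplex y).preimage p

lemma mem_fiber_iff {X Y : SSet.{u}} (p : X ⟶ Y) (y : Y _⦋0⦌) {n : SimplexCategoryᵒᵖ}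
    (x : X.obj n) : x ∈ (fiber p y).obj n ↔ p.app n x = (SSet.const (X := X) y).app n x := by
  have hx : x ∈ (fiber p y).obj n ↔ p.app n x ∈ (SSet.Subcomplex.ofSimplex y).obj n := Iff.rfl
  rw [hx, SSet.Subcomplex.mem_ofSimplex_obj_iff]
  constructor
  · rintro ⟨f, hf⟩
    rw [← hf, Subsingleton.elim f (n.unop.const _ 0)]
    rfl
  · intro h
    exact ⟨n.unop.const _ 0, h.symm⟩

/-- The evaluation `Y^{Δ[1]} ⟶ Y` at the vertex `v` of `Δ[1]`. -/
def evalAt (Y : SSet.{u}) (v : Fin 2) : (ihom Δ[1]).obj Y ⟶ Y :=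
  CartesianMonoidalCategory.lift (SSet.const (SSet.stdSimplex.obj₀Equiv.symm v)) (𝟙 _) ≫
    (ihom.ev Δ[1]).app Y

/-- The loop space `Ω(Y, y)`, the subspace of `Y^{Δ[1]}` of those paths that start and end
at `y`. It has the correct homotopy type when `Y` is a Kan complex. -/
def loopSpace (Y : SSet.{u}) (y : Y _⦋0⦌) : ((ihom Δ[1]).obj Y).Subcomplex :=
  fiber (evalAt Y 0) y ⊓ fiber (evalAt Y 1) y

lemma evalAt_naturality {Y Y' : SSet.{u}} (f : Y ⟶ Y') (v : Fin 2) :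
    (ihom Δ[1]).map f ≫ evalAt Y' v = evalAt Y v ≫ f := by
  have h := (ihom.ev Δ[1]).naturality f
  simp only [Functor.comp_map, Functor.id_map] at h
  simp only [evalAt, Category.assoc]
  erw [← h]
  rfl

lemma curry_evalAt {X Y : SSet.{u}} (g : Δ[1] ⊗ X ⟶ Y) (v : Fin 2) :
    MonoidalClosed.curry g ≫ evalAt Y v =
      CartesianMonoidalCategory.lift
        (SSet.const (SSet.stdSimplex.obj₀Equiv.symm v)) (𝟙 _) ≫ g := by
  conv_rhs => rw [← MonoidalClosed.whiskerLeft_curry_ihom_ev_app _ _ g]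
  rfl

lemma mem_fiber_comp {X Y Z : SSet.{u}} (p : X ⟶ Y) (f : Y ⟶ Z) (y : Y _⦋0⦌) (z : Z _⦋0⦌)
    (h : f.app _ y = z) {n : SimplexCategoryᵒᵖ} (x : X.obj n) (hx : x ∈ (fiber p y).obj n) :
    x ∈ (fiber (p ≫ f) z).obj n := by
  subst h
  rw [mem_fiber_iff] at hx ⊢
  rw [← SSet.const_comp, SSet.comp_app, SSet.comp_app, types_comp_apply, types_comp_apply, hx]

/-- The map `Ω(Y, y) ⟶ Ω(Y', y')` induced by a map `f : Y ⟶ Y'` with `f(y) = y'`. -/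
def loopSpaceMap {Y Y' : SSet.{u}} (f : Y ⟶ Y') (y : Y _⦋0⦌) (y' : Y' _⦋0⦌)
    (h : f.app _ y = y') : (loopSpace Y y : SSet.{u}) ⟶ (loopSpace Y' y' : SSet.{u}) :=
  SSet.Subcomplex.lift ((loopSpace Y y).ι ≫ (ihom Δ[1]).map f) (by
    rintro n _ ⟨x, rfl⟩
    obtain ⟨x, h0, h1⟩ := x
    refine ⟨?_, ?_⟩
    · have := mem_fiber_comp _ f y y' h x h0
      rw [← evalAt_naturality] at this
      exact this
    · have := mem_fiber_comp _ f y y' h x h1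
      rw [← evalAt_naturality] at this
      exact this)

/-! ### Groupoid objects in simplicial sets -/

/-- A simplicial groupoid, i.e. a groupoid object in simplicial sets. The composite `m (f, g)` is
"first `f`, then `g`", defined if `t f = s g`. -/
structure SimplicialGroupoid where
  /-- the simplicial set of objects -/
  ob : SSet.{u}
  /-- the simplicial set of arrows -/
  ar : SSet.{u}
  /-- source -/
  s : ar ⟶ ob
  /-- target -/
  t : ar ⟶ ob
  /-- identities -/
  e : ob ⟶ ar
  /-- inverses -/
  i : ar ⟶ ar
  /-- composition -/
  m : fiberProd t s ⟶ ar
  e_s : e ≫ s = 𝟙 ob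
  e_t : e ≫ t = 𝟙 ob
  i_s : i ≫ s = t
  i_t : i ≫ t = s
  m_s : m ≫ s = fiberProd.fst t s ≫ s
  m_t : m ≫ t = fiberProd.snd t s ≫ t
  id_comp (n : SimplexCategoryᵒᵖ) (f : ar.obj n)
    (h : t.app n (e.app n (s.app n f)) = s.app n f) :
    m.app n ⟨(e.app n (s.app n f), f), h⟩ = f
  comp_id (n : SimplexCategoryᵒᵖ) (f : ar.obj n)
    (h : t.app n f = s.app n (e.app n (t.app n f))) :
    m.app n ⟨(f, e.app n (t.app n f)), h⟩ = f
  assoc (n : SimplexCategoryᵒᵖ) (f g k : ar.obj n)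
    (h : t.app n f = s.app n g) (h' : t.app n g = s.app n k)
    (h₁ : t.app n (m.app n ⟨(f, g), h⟩) = s.app n k)
    (h₂ : t.app n f = s.app n (m.app n ⟨(g, k), h'⟩)) :
    m.app n ⟨(m.app n ⟨(f, g), h⟩, k), h₁⟩ = m.app n ⟨(f, m.app n ⟨(g, k), h'⟩), h₂⟩
  inv_comp (n : SimplexCategoryᵒᵖ) (f : ar.obj n) (h : t.app n (i.app n f) = s.app n f) :
    m.app n ⟨(i.app n f, f), h⟩ = e.app n (t.app n f)
  comp_inv (n : SimplexCategoryᵒᵖ) (f : ar.obj n) (h : t.app n f = s.app n (i.app n f)) :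
    m.app n ⟨(f, i.app n f), h⟩ = e.app n (s.app n f)

namespace SimplicialGroupoid

section

variable (G : SimplicialGroupoid.{u}) {n : SimplexCategoryᵒᵖ}

lemma s_e (x : G.ob.obj n) : G.s.app n (G.e.app n x) = x :=
  ConcreteCategory.congr_hom (congr_app G.e_s n) x

lemma t_e (x : G.ob.obj n) : G.t.app n (G.e.app n x) = x :=
  ConcreteCategory.congr_hom (congr_app G.e_t n) x

lemma s_i (f : G.ar.obj n) : G.s.app n (G.i.app n f) = G.t.app n f :=
  ConcreteCategory.congr_hom (congr_app G.i_s n) f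

lemma t_i (f : G.ar.obj n) : G.t.app n (G.i.app n f) = G.s.app n f :=
  ConcreteCategory.congr_hom (congr_app G.i_t n) f

lemma s_m (p : (fiberProd G.t G.s).obj n) :
    G.s.app n (G.m.app n p) = G.s.app n p.1.1 :=
  ConcreteCategory.congr_hom (congr_app G.m_s n) p

lemma t_m (p : (fiberProd G.t G.s).obj n) :
    G.t.app n (G.m.app n p) = G.t.app n p.1.2 :=
  ConcreteCategory.congr_hom (congr_app G.m_t n) p

end

/-- A morphism of simplicial groupoids (an internal functor). -/
structure Hom (G H : SimplicialGroupoid.{u}) where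
  /-- the map on objects -/
  ob : G.ob ⟶ H.ob
  /-- the map on arrows -/
  ar : G.ar ⟶ H.ar
  comm_s : ar ≫ H.s = G.s ≫ ob
  comm_t : ar ≫ H.t = G.t ≫ ob
  comm_e : G.e ≫ ar = ob ≫ H.e
  comm_m (n : SimplexCategoryᵒᵖ) (f g : G.ar.obj n) (h : G.t.app n f = G.s.app n g)
    (h' : H.t.app n (ar.app n f) = H.s.app n (ar.app n g)) :
    ar.app n (G.m.app n ⟨(f, g), h⟩) = H.m.app n ⟨(ar.app n f, ar.app n g), h'⟩

namespace Hom

variable {G H : SimplicialGroupoid.{u}} (F : Hom G H) {n : SimplexCategoryᵒᵖ}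

lemma s_ar (f : G.ar.obj n) : H.s.app n (F.ar.app n f) = F.ob.app n (G.s.app n f) :=
  ConcreteCategory.congr_hom (congr_app F.comm_s n) f

lemma t_ar (f : G.ar.obj n) : H.t.app n (F.ar.app n f) = F.ob.app n (G.t.app n f) :=
  ConcreteCategory.congr_hom (congr_app F.comm_t n) f

lemma ar_e (x : G.ob.obj n) : F.ar.app n (G.e.app n x) = H.e.app n (F.ob.app n x) :=
  ConcreteCategory.congr_hom (congr_app F.comm_e n) x

end Hom

/-- The set of objects of the groupoid `G_n` of `n`-simplices of `G`. -/
def Obj (G : SimplicialGroupoid.{u}) (n : SimplexCategoryᵒᵖ) : Type u := G.ob.obj n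

/-- The groupoid `G_n` of `n`-simplices of `G`. -/
instance (G : SimplicialGroupoid.{u}) (n : SimplexCategoryᵒᵖ) : Groupoid.{u} (G.Obj n) where
  Hom x y := {f : G.ar.obj n // G.s.app n f = x ∧ G.t.app n f = y}
  id x := ⟨G.e.app n x, G.s_e x, G.t_e x⟩
  comp f g := ⟨G.m.app n ⟨(f.1, g.1), f.2.2.trans g.2.1.symm⟩,
    (G.s_m _).trans f.2.1, (G.t_m _).trans g.2.2⟩
  id_comp := by
    rintro x y ⟨f, rfl, rfl⟩
    exact Subtype.ext (G.id_comp _ _ _)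
  comp_id := by
    rintro x y ⟨f, rfl, rfl⟩
    exact Subtype.ext (G.comp_id _ _ _)
  assoc f g k := Subtype.ext (G.assoc _ _ _ _ _ _ _ _)
  inv f := ⟨G.i.app n f.1, (G.s_i _).trans f.2.2, (G.t_i _).trans f.2.1⟩
  inv_comp := by
    rintro x y ⟨f, rfl, rfl⟩
    exact Subtype.ext (G.inv_comp _ _ _)
  comp_inv := by
    rintro x y ⟨f, rfl, rfl⟩
    exact Subtype.ext (G.comp_inv _ _ _)

lemma eqToHom_comp_val (G : SimplicialGroupoid.{u}) {n : SimplexCategoryᵒᵖ}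
    {x x' y y' : G.Obj n} (h : x = x') (f : x' ⟶ y') (h' : y' = y) :
    (eqToHom h ≫ f ≫ eqToHom h').1 = f.1 := by
  subst h h'
  simp

lemma functor_ext (G : SimplicialGroupoid.{u}) {n : SimplexCategoryᵒᵖ} {C : Type*} [Category* C]
    {F F' : C ⥤ G.Obj n} (hob : ∀ x, F.obj x = F'.obj x)
    (har : ∀ {x y : C} (f : x ⟶ y), (F.map f).1 = (F'.map f).1) : F = F' := by
  refine Functor.hext hob fun x y f ↦ ?_
  have key : ∀ {a b a' b' : G.Obj n} (_ : a = a') (_ : b = b') (p : a ⟶ b) (q : a' ⟶ b'),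
      p.1 = q.1 → HEq p q := by
    rintro a b _ _ rfl rfl p q hpq
    exact heq_of_eq (Subtype.ext hpq)
  exact key (hob x) (hob y) _ _ (har f)

/-- The functor `G_n ⥤ G_m` given by a simplicial operator. -/
@[simps]
def mapFunctor (G : SimplicialGroupoid.{u}) {n m : SimplexCategoryᵒᵖ} (φ : n ⟶ m) :
    G.Obj n ⥤ G.Obj m where
  obj x := G.ob.map φ x
  map f := ⟨G.ar.map φ f.1, by rw [NatTrans.naturality_apply, f.2.1],
    by rw [NatTrans.naturality_apply, f.2.2]⟩
  map_id x := Subtype.ext (NatTrans.naturality_apply G.e φ x).symm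
  map_comp f g := Subtype.ext
    (NatTrans.naturality_apply G.m φ ⟨(f.1, g.1), f.2.2.trans g.2.1.symm⟩).symm

/-- The functor `G_n ⥤ H_n` given by a morphism of simplicial groupoids. -/
@[simps]
def Hom.functor {G H : SimplicialGroupoid.{u}} (F : Hom G H) (n : SimplexCategoryᵒᵖ) :
    G.Obj n ⥤ H.Obj n where
  obj x := F.ob.app n x
  map f := ⟨F.ar.app n f.1, by rw [F.s_ar, f.2.1], by rw [F.t_ar, f.2.2]⟩
  map_id x := Subtype.ext (F.ar_e x)
  map_comp f g := Subtype.ext (F.comm_m _ _ _ _ _)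

/-- The nerve `N(G)` as a bisimplicial set: `(N(G).obj q).obj p` is the set of strings of `p`
composable arrows in the groupoid `G_q`. -/
@[simps]
def biNerve (G : SimplicialGroupoid.{u}) : SimplexCategoryᵒᵖ ⥤ SSet.{u} where
  obj n := nerve (G.Obj n)
  map φ := nerveMap (G.mapFunctor φ)
  map_id n := by
    have : G.mapFunctor (𝟙 n) = 𝟭 _ := G.functor_ext
      (fun x ↦ Functor.map_id_apply G.ob n x) (fun f ↦ by exact Functor.map_id_apply G.ar n f.1)
    rw [this]; rfl
  map_comp φ ψ := by
    have : G.mapFunctor (φ ≫ ψ) = G.mapFunctor φ ⋙ G.mapFunctor ψ :=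
      G.functor_ext (fun x ↦ Functor.map_comp_apply G.ob φ ψ x)
        (fun f ↦ by exact Functor.map_comp_apply G.ar φ ψ f.1)
    rw [this]; rfl

/-- The map of nerves given by a morphism of simplicial groupoids. -/
@[simps]
def Hom.biNerveMap {G H : SimplicialGroupoid.{u}} (F : Hom G H) : G.biNerve ⟶ H.biNerve where
  app n := nerveMap (F.functor n)
  naturality n m φ := by
    have : G.mapFunctor φ ⋙ F.functor m = F.functor n ⋙ H.mapFunctor φ :=
      H.functor_ext (fun x ↦ NatTrans.naturality_apply F.ob φ x)
        (fun f ↦ by exact NatTrans.naturality_apply F.ar φ f.1)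
    change nerveMap (G.mapFunctor φ ⋙ F.functor m) = nerveMap (F.functor n ⋙ H.mapFunctor φ)
    rw [this]

/-- The classifying space `BG = δ^* N(G)`. -/
def B (G : SimplicialGroupoid.{u}) : SSet.{u} := diag G.biNerve

/-- The map `BG ⟶ BH` given by a morphism of simplicial groupoids. -/
def Hom.B {G H : SimplicialGroupoid.{u}} (F : Hom G H) : G.B ⟶ H.B := diagMap F.biNerveMap

/-- A left action of the simplicial groupoid `G` on `π : X ⟶ ob(G)`: `act (g, x)` is `g · x`,
defined if `s g = π x`. -/
structure LeftAction (G : SimplicialGroupoid.{u}) {X : SSet.{u}} (π : X ⟶ G.ob) where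
  /-- the action map -/
  act : fiberProd G.s π ⟶ X
  act_π : act ≫ π = fiberProd.fst G.s π ≫ G.t
  id_act (n : SimplexCategoryᵒᵖ) (x : X.obj n)
    (h : G.s.app n (G.e.app n (π.app n x)) = π.app n x) :
    act.app n ⟨(G.e.app n (π.app n x), x), h⟩ = x
  comp_act (n : SimplexCategoryᵒᵖ) (f g : G.ar.obj n) (x : X.obj n)
    (hx : G.s.app n f = π.app n x) (h : G.t.app n f = G.s.app n g)
    (h₁ : G.s.app n (G.m.app n ⟨(f, g), h⟩) = π.app n x)
    (h₂ : G.s.app n g = π.app n (act.app n ⟨(f, x), hx⟩)) :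
    act.app n ⟨(G.m.app n ⟨(f, g), h⟩, x), h₁⟩ =
      act.app n ⟨(g, act.app n ⟨(f, x), hx⟩), h₂⟩

namespace LeftAction

variable {G : SimplicialGroupoid.{u}} {X : SSet.{u}} {π : X ⟶ G.ob} (A : LeftAction G π)

lemma π_act {n : SimplexCategoryᵒᵖ} (p : (fiberProd G.s π).obj n) :
    π.app n (A.act.app n p) = G.t.app n p.1.1 :=
  ConcreteCategory.congr_hom (congr_app A.act_π n) p

/-- The action groupoid `X_G`, with `ob(X_G) = X` and `ar(X_G) = ar(G) ×_{ob(G)} X`; the arrow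
`(g, x)` goes from `x` to `g · x`. -/
def actionGroupoid : SimplicialGroupoid.{u} where
  ob := X
  ar := fiberProd G.s π
  s := fiberProd.snd G.s π
  t := A.act
  e :=
    { app n := ↾fun x ↦ ⟨(G.e.app n (π.app n x), x), G.s_e _⟩
      naturality n m φ := by
        ext x
        refine Subtype.ext (Prod.ext ?_ rfl)
        change G.e.app m (π.app m (X.map φ x)) = G.ar.map φ (G.e.app n (π.app n x))
        rw [NatTrans.naturality_apply, NatTrans.naturality_apply] }
  i :=
    { app n := ↾fun p ↦ ⟨(G.i.app n p.1.1, A.act.app n p), (G.s_i _).trans (A.π_act p).symm⟩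
      naturality n m φ := by
        ext p
        exact Subtype.ext (Prod.ext (by exact NatTrans.naturality_apply G.i φ p.1.1)
          (by exact NatTrans.naturality_apply A.act φ p)) }
  m :=
    { app n := ↾fun p ↦ ⟨(G.m.app n ⟨(p.1.1.1.1, p.1.2.1.1), by
          rw [p.1.2.2, ← A.π_act p.1.1]
          exact congrArg (π.app n) p.2⟩, p.1.1.1.2), (G.s_m _).trans p.1.1.2⟩
      naturality n m φ := by
        ext p
        refine Subtype.ext (Prod.ext ?_ rfl)
        exact NatTrans.naturality_apply G.m φ ⟨(p.1.1.1.1, p.1.2.1.1), _⟩ }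
  e_s := rfl
  e_t := by
    ext n x
    exact A.id_act n x _
  i_s := rfl
  i_t := by
    ext n p
    have h := A.comp_act n p.1.1 (G.i.app n p.1.1) p.1.2 p.2 (G.s_i _).symm
      ((G.s_m _).trans p.2) ((G.s_i _).trans (A.π_act p).symm)
    refine h.symm.trans ?_
    have hp := A.id_act n p.1.2 (G.s_e _)
    have hm := (G.comp_inv n p.1.1 (G.s_i _).symm).trans (congrArg (G.e.app n) p.2)
    refine Eq.trans ?_ hp
    exact congrArg (A.act.app n) (Subtype.ext (Prod.ext (by exact hm) rfl))
  m_s := rfl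
  m_t := by
    ext n ⟨⟨⟨⟨f, x⟩, hf⟩, ⟨⟨g, y⟩, hg⟩⟩, h⟩
    have h' : A.act.app n ⟨(f, x), hf⟩ = y := h
    subst h'
    exact A.comp_act n f g x hf _ _ hg
  id_comp n p h := by
    obtain ⟨⟨f, x⟩, hf⟩ := p
    refine Subtype.ext (Prod.ext ?_ rfl)
    have hf' : G.s.app n f = π.app n x := hf
    have key : ∀ (z : G.ob.obj n) (hz : G.s.app n f = z)
        (hh : G.t.app n (G.e.app n z) = G.s.app n f),
        G.m.app n ⟨(G.e.app n z, f), hh⟩ = f := by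
      rintro z rfl hh
      exact G.id_comp n f hh
    exact key _ hf' _
  comp_id n p h := by
    obtain ⟨⟨f, x⟩, hf⟩ := p
    refine Subtype.ext (Prod.ext ?_ rfl)
    have key : ∀ (z : G.ob.obj n) (hz : G.t.app n f = z)
        (hh : G.t.app n f = G.s.app n (G.e.app n z)),
        G.m.app n ⟨(f, G.e.app n z), hh⟩ = f := by
      rintro z rfl hh
      exact G.comp_id n f hh
    exact key _ (A.π_act ⟨(f, x), hf⟩).symm _
  assoc n p q r h h' h₁ h₂ := Subtype.ext (Prod.ext (G.assoc _ _ _ _ _ _ _ _) rfl)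
  inv_comp n p h := by
    refine Subtype.ext (Prod.ext ?_ rfl)
    refine (G.inv_comp _ _ _).trans ?_
    exact congrArg (G.e.app n) (A.π_act p).symm
  comp_inv n p h := by
    refine Subtype.ext (Prod.ext ?_ rfl)
    refine (G.comp_inv _ _ _).trans ?_
    exact congrArg (G.e.app n) p.2

/-- The projection `X_G ⟶ G`, given by `π` on objects and `(g, x) ↦ g` on arrows. -/
def proj : Hom A.actionGroupoid G where
  ob := π
  ar := fiberProd.fst G.s π
  comm_s := by
    ext n p
    exact p.2
  comm_t := A.act_π.symm
  comm_e := rfl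
  comm_m _ _ _ _ _ := rfl

end LeftAction

/-! ### The comparison map from `G(c, c)` to the loop space of `BG` -/

/-- The simplicial set (in fact simplicial group) `G(c, c)` of arrows from `c` to `c`. -/
def endo (G : SimplicialGroupoid.{u}) (c : G.ob _⦋0⦌) : G.ar.Subcomplex :=
  fiber G.s c ⊓ fiber G.t c

/-- The map `G(c, c) ⟶ H(F c, F c)` given by a morphism `F` of simplicial groupoids. -/
def Hom.endo {G H : SimplicialGroupoid.{u}} (F : Hom G H) (c : G.ob _⦋0⦌) :
    (G.endo c : SSet.{u}) ⟶ (H.endo (F.ob.app _ c) : SSet.{u}) :=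
  SSet.Subcomplex.lift ((G.endo c).ι ≫ F.ar) (by
    rintro n _ ⟨⟨f, h0, h1⟩, rfl⟩
    refine ⟨?_, ?_⟩
    · have := mem_fiber_comp _ F.ob c _ rfl f h0
      rw [← F.comm_s] at this
      exact this
    · have := mem_fiber_comp _ F.ob c _ rfl f h1
      rw [← F.comm_t] at this
      exact this)

/-- The vertex of `BG` given by an object `c`. -/
def vertex (G : SimplicialGroupoid.{u}) (c : G.ob _⦋0⦌) : G.B _⦋0⦌ :=
  ComposableArrows.mk₀ (C := G.Obj (op ⦋0⦌)) c

/-- An `n`-simplex of `ar(G)`, as a functor from `[1]` to the groupoid `G_n`. -/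
def arrow (G : SimplicialGroupoid.{u}) {n : SimplexCategoryᵒᵖ} (f : G.ar.obj n) :
    ComposableArrows (G.Obj n) 1 :=
  ComposableArrows.mk₁ (X₀ := (G.s.app n f : G.Obj n)) (X₁ := (G.t.app n f : G.Obj n))
    ⟨f, rfl, rfl⟩

lemma arrow_map (G : SimplicialGroupoid.{u}) {n m : SimplexCategoryᵒᵖ} (φ : n ⟶ m)
    (f : G.ar.obj n) : G.arrow (G.ar.map φ f) = G.arrow f ⋙ G.mapFunctor φ := by
  refine ComposableArrows.ext₁ ?_ ?_ ?_
  · exact NatTrans.naturality_apply G.s φ f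
  · exact NatTrans.naturality_apply G.t φ f
  · refine Subtype.ext ?_
    exact (G.eqToHom_comp_val (n := m) _ ((G.mapFunctor φ).map
      (X := (G.s.app n f : G.Obj n)) (Y := (G.t.app n f : G.Obj n)) ⟨f, rfl, rfl⟩) _).symm

/-- The map `Δ[1] × ar(G) ⟶ BG` that sends `(α, f)` in degree `n`, where `α : [n] ⟶ [1]` and `f`
is an arrow of `G_n`, to the string of `n` arrows in `G_n` that is the composite
`[n] ⟶ [1] ⟶ G_n` of `α` and `f`. -/
def arrowPath (G : SimplicialGroupoid.{u}) : Δ[1] ⊗ G.ar ⟶ G.B where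
  app n := ↾fun p ↦
    (nerve (G.Obj n)).map (SSet.stdSimplex.objEquiv p.1).op (G.arrow p.2)
  naturality n m φ := by
    ext ⟨α, f⟩
    change (nerve (G.Obj m)).map (SSet.stdSimplex.objEquiv (Δ[1].map φ α)).op
      (G.arrow (G.ar.map φ f)) = _
    rw [arrow_map]
    rfl

lemma arrowPath_vertex (G : SimplicialGroupoid.{u}) (c : G.ob _⦋0⦌) (v : Fin 2)
    {n : SimplexCategoryᵒᵖ} (f : G.ar.obj n)
    (h : (G.arrow f).obj v = (SSet.const (X := G.ob) c).app n (G.s.app n f)) :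
    (nerve (G.Obj n)).map (SimplexCategory.const n.unop ⦋1⦌ v).op (G.arrow f) =
      G.B.map (SimplexCategory.const n.unop ⦋0⦌ 0).op (G.vertex c) := by
  have aux (x : G.Obj n) (x' : G.Obj n) (hx : x = x') :
    G.e.app n x = G.e.app n x' := by rw [hx]
  refine G.functor_ext (fun _ ↦ h) (fun g ↦ ?_)
  have h1 : (G.arrow f).map (𝟙 v) = 𝟙 _ := (G.arrow f).map_id v
  have h2 : (G.arrow f).map (𝟙 v) = ((nerve (G.Obj n)).map
    (SimplexCategory.const n.unop ⦋1⦌ v).op (G.arrow f)).map g := rfl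
  rw [← h2, h1]
  refine (aux _ _ h).trans ?_
  have h3 := NatTrans.naturality_apply G.e (SimplexCategory.const n.unop ⦋0⦌ 0).op c
  exact h3

lemma curry_arrowPath_mem (G : SimplicialGroupoid.{u}) (c : G.ob _⦋0⦌) (v : Fin 2)
    {n : SimplexCategoryᵒᵖ} (f : G.ar.obj n)
    (h : (G.arrow f).obj v = (SSet.const (X := G.ob) c).app n (G.s.app n f)) :
    (MonoidalClosed.curry G.arrowPath).app n f ∈ (fiber (evalAt G.B v) (G.vertex c)).obj n := by
  have h1 : (MonoidalClosed.curry G.arrowPath ≫ evalAt G.B v).app n f =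
      (nerve (G.Obj n)).map (SimplexCategory.const n.unop ⦋1⦌ v).op (G.arrow f) := by
    rw [curry_evalAt]
    rfl
  rw [mem_fiber_iff]
  rw [SSet.comp_app, types_comp_apply, G.arrowPath_vertex c v f h] at h1
  rw [h1]
  rfl

/-- The canonical map `G(c, c) ⟶ Ω(BG, c)`, which views an arrow `c ⟶ c` as a loop. -/
def toLoopSpace (G : SimplicialGroupoid.{u}) (c : G.ob _⦋0⦌) :
    (G.endo c : SSet.{u}) ⟶ (loopSpace G.B (G.vertex c) : SSet.{u}) :=
  SSet.Subcomplex.lift ((G.endo c).ι ≫ MonoidalClosed.curry G.arrowPath) (by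
    rintro n _ ⟨⟨f, h0, h1⟩, rfl⟩
    rw [mem_fiber_iff] at h0 h1
    exact ⟨G.curry_arrowPath_mem c 0 f h0, G.curry_arrowPath_mem c 1 f h1⟩)

lemma Hom.B_vertex {G H : SimplicialGroupoid.{u}} (F : Hom G H) (c : G.ob _⦋0⦌) :
    F.B.app _ (G.vertex c) = H.vertex (F.ob.app _ c) :=
  ComposableArrows.ext₀ rfl

end SimplicialGroupoid

end SimplicialGroupoids

end

open SimplicialGroupoids

/-!
All parts rest on a model of the classifying space `BG` that treats the vertices of a simplex
symmetrically: a string of `n` arrows in the groupoid `G_n` is the same as a matrix of arrows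
`f i j`, indexed by pairs of vertices of `Δ[n]`, such that `f i j` followed by `f j k` is `f i k`.
This gives an isomorphism `G.toW` from `BG` to a simplicial set `G.W`. A matrix is determined by any
of its rows, and any tuple `g` of arrows with a common source has a matrix `(g i)⁻¹ ≫ g j`.

For a simplicial set `E` let `tup E` be the simplicial set of `(n + 1)`-tuples of `n`-simplices
of `E`, one for each vertex of `Δ[n]`. In a boundary of tuples, or in a horn of tuples at the
vertex `i`, the entries at `i` form a horn in `E`, because only the faces that contain `i` have such
an entry. Hence a horn of tuples can be filled at its own vertex (`exists_vertex_filler`), and a Kan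
fibration that is surjective on vertices becomes a trivial fibration on tuples (`trivFib_tupMap`).

* `BG` is a Kan complex: tuples of arrows with a common source form a Kan complex, by
  `trivFib_tupMap` for the source map. Given a horn of matrices at the vertex `i`, its rows at `i`
  are filled by such a tuple, and the matrix of this tuple fills the horn (`kanComplex_W`).
* For an action on `π`, a horn is filled at its vertex by means of `π`, and the action determines
  the rest of the filler (`fibration_proj_W`).
* If the groupoids `G_n` are transitive, horns in `ar(G)` are filled as in Moore's theorem that
  simplicial groups are Kan complexes (`fibration_lift_s_t`).
* For the comparison with the loop space, suppose first that `ob(G)` is a Kan complex. Tuples of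
  arrows out of `c` form a contractible simplicial set `tup (G.under c)`, the matrix of a tuple
  is a Kan fibration `pathFib` from it to `G.W`, and its fibre over `c` is `G(c, c)`. The paths that
  start at the identity of `c` and end in that fibre map by trivial fibrations both to the loop
  space of `G.W` and to `G(c, c)`, and `λ_c` comes from an explicit section of the latter
  (`isWeakEquiv_toLoopSpace_of_kanComplex_ob`).
* In general, let `D` be the restriction of `G` to the discrete simplicial set of the vertices of
  `ob(G)`. Matrices of `D` together with an arrow of `G` out of each of their objects form a
  simplicial set `extMat` that contracts to `D.W` and maps to `G.W`, by conjugation, by a trivial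
  fibration. So `BD` is a Kan complex that is weakly equivalent to `BG`, and `D(c, c)` is `G(c, c)`.
  As weak equivalences of Kan complexes induce weak equivalences of loop spaces
  (`IsWeakEquiv.isLoopEquiv`), the general case follows from that of `D`
  (`isWeakEquiv_toLoopSpace_comp`).

Weak equivalences are defined by homotopy classes of maps to Kan complexes. For these only formal
facts are needed: the two-out-of-three and two-out-of-six properties and homotopy invariance, which
makes trivial fibrations weak equivalences.
-/


noncomputable section

namespace SimplicialGroupoids

/-! ### Horns and boundaries in terms of elements -/

section Faces

variable {X Y : SSet.{u}} {n : ℕ}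

/-- A family of `n`-simplices `y j`, for the `j : Fin (n + 2)` with `S j`, is a *face family* if
any two of its members agree wherever the corresponding faces of `Δ[n + 1]` meet. Such families
are the maps to `X` from the union of the faces of `Δ[n + 1]` indexed by `S`. -/
def IsFaceFamily (S : Fin (n + 2) → Prop) (y : ∀ j, S j → X _⦋n⦌) : Prop :=
  ∀ (m : ℕ) (φ ψ : ⦋m⦌ ⟶ ⦋n⦌) (j k : Fin (n + 2)) (hj : S j) (hk : S k),
    φ ≫ SimplexCategory.δ j = ψ ≫ SimplexCategory.δ k →
      X.map φ.op (y j hj) = X.map ψ.op (y k hk)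

lemma map_comp_apply (X : SSet.{u}) {a b c : SimplexCategory} (φ : a ⟶ b) (ψ : b ⟶ c)
    (x : X.obj (op c)) : X.map (φ ≫ ψ).op x = X.map φ.op (X.map ψ.op x) := by
  rw [op_comp]; exact Functor.map_comp_apply X _ _ x

/-- To show that a map is a Kan fibration, it suffices to fill horns given by their faces. -/
lemma fibration_of_filler (p : X ⟶ Y)
    (H : ∀ (n : ℕ) (i : Fin (n + 2)) (y : ∀ j, j ≠ i → X _⦋n⦌) (b : Y _⦋n + 1⦌),
      IsFaceFamily (· ≠ i) y → (∀ j hj, p.app _ (y j hj) = Y.δ j b) →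
      ∃ x : X _⦋n + 1⦌, (∀ j hj, X.δ j x = y j hj) ∧ p.app _ x = b) :
    Fibration p := by
  rw [SSet.modelCategoryQuillen.fibration_iff]
  intro _ _ _ h
  simp only [SSet.modelCategoryQuillen.J, MorphismProperty.iSup_iff] at h
  obtain ⟨n, ⟨i⟩⟩ := h
  refine ⟨fun {f g} sq ↦ ?_⟩
  obtain ⟨x, hx, hb⟩ := H n i (fun j hj ↦ SSet.yonedaEquiv (SSet.horn.ι i j hj ≫ f))
    (SSet.yonedaEquiv g) (by
      intro m φ ψ j k hj hk h
      rw [SSet.yonedaEquiv_naturality, SSet.yonedaEquiv_naturality, ← Category.assoc,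
        ← Category.assoc]
      congr 2
      rw [← cancel_mono (Subfunctor.ι _), Category.assoc, Category.assoc, SSet.horn.ι_ι,
        SSet.horn.ι_ι]
      refine ((SSet.stdSimplex.map_comp _ _).symm.trans ?_).trans (SSet.stdSimplex.map_comp _ _)
      rw [h]) (by
      intro j hj
      rw [← SSet.stdSimplex.yonedaEquiv_δ_comp, ← SSet.horn.ι_ι i j hj, Category.assoc, ← sq.w,
        ← Category.assoc]
      rfl)
  refine ⟨⟨{ l := SSet.yonedaEquiv.symm x, fac_left := ?_, fac_right := ?_ }⟩⟩
  · refine SSet.horn.hom_ext' fun j hj ↦ ?_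
    rw [SSet.horn.ι_ι_assoc, SSet.stdSimplex.δ_comp_yonedaEquiv_symm, hx j hj,
      Equiv.symm_apply_apply]
  · rw [SSet.yonedaEquiv_symm_comp, hb, Equiv.symm_apply_apply]

/-- Horn filling along a Kan fibration. The compatibility of the faces `y j` is only required on
simplices that contain the vertex `i` of the horn. -/
lemma exists_filler (p : X ⟶ Y) [Fibration p] (i : Fin (n + 2)) (y : ∀ j, j ≠ i → X _⦋n⦌)
    (b : Y _⦋n + 1⦌)
    (hy : ∀ (m : ℕ) (φ ψ : ⦋m⦌ ⟶ ⦋n⦌) (j k : Fin (n + 2)) (hj : j ≠ i) (hk : k ≠ i)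
      (q : Fin (m + 1)), j.succAbove (φ.toOrderHom q) = i →
      φ ≫ SimplexCategory.δ j = ψ ≫ SimplexCategory.δ k →
      X.map φ.op (y j hj) = X.map ψ.op (y k hk))
    (hb : ∀ j hj, p.app _ (y j hj) = Y.δ j b) :
    ∃ x : X _⦋n + 1⦌, (∀ j hj, X.δ j x = y j hj) ∧ p.app _ x = b := by
  obtain ⟨φ, hφ, hφ'⟩ := SSet.horn.IsCompatible.exists_lift (i := i)
    (f := fun j hj ↦ SSet.yonedaEquiv.symm (y j hj)) (by
      obtain _ | n := n
      · trivial
      · rw [SSet.horn.isCompatible_iff]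
        intro j k hj hk hjk
        obtain ⟨j, rfl⟩ := j.eq_castSucc_of_ne_last (Fin.ne_last_of_lt hjk)
        obtain ⟨k, rfl⟩ := k.eq_succ_of_ne_zero (Fin.ne_zero_of_lt hjk)
        rw [SSet.stdSimplex.δ_comp_yonedaEquiv_symm, SSet.stdSimplex.δ_comp_yonedaEquiv_symm]
        congr 1
        rw [Fin.pred_succ, Fin.castPred_castSucc]
        have hjk' : j ≤ k := Fin.castSucc_lt_succ_iff.1 hjk
        have h1 : ∃ q', j.castSucc.succAbove q' = i := Fin.exists_succAbove_eq hj.symm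
        obtain ⟨q', hq'⟩ := h1
        have h2 : q' ≠ k := by
          rintro rfl
          apply hk
          rw [← hq', Fin.succAbove_of_le_castSucc]
          simpa using hjk'
        obtain ⟨q, hq⟩ := Fin.exists_succAbove_eq h2
        refine hy n (SimplexCategory.δ k) (SimplexCategory.δ j) _ _ hj hk q ?_ ?_
        · rw [← hq', ← hq]; rfl
        · exact (SimplexCategory.δ_comp_δ hjk').symm) p (SSet.yonedaEquiv.symm b) (by
      intro j hj
      rw [SSet.yonedaEquiv_symm_comp, SSet.stdSimplex.δ_comp_yonedaEquiv_symm, hb j hj])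
  refine ⟨SSet.yonedaEquiv φ, fun j hj ↦ ?_, ?_⟩
  · rw [← SSet.stdSimplex.yonedaEquiv_δ_comp, hφ j hj, Equiv.apply_symm_apply]
  · rw [← SSet.yonedaEquiv_comp, hφ', Equiv.apply_symm_apply]

/-- A trivial fibration is a map with the right lifting property with respect to all
monomorphisms. -/
abbrev TrivFib (p : X ⟶ Y) : Prop := (MorphismProperty.monomorphisms SSet.{u}).rlp p

/-- To show that a map is a trivial fibration, it suffices to lift vertices and to fill
boundaries given by their faces. -/
lemma trivFib_of_filler (p : X ⟶ Y) (H₀ : ∀ b : Y _⦋0⦌, ∃ x : X _⦋0⦌, p.app _ x = b)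
    (H : ∀ (n : ℕ) (y : ∀ _ : Fin (n + 2), True → X _⦋n⦌) (b : Y _⦋n + 1⦌),
      IsFaceFamily (fun _ ↦ True) y → (∀ j hj, p.app _ (y j hj) = Y.δ j b) →
      ∃ x : X _⦋n + 1⦌, (∀ j hj, X.δ j x = y j hj) ∧ p.app _ x = b) :
    TrivFib p := by
  change (MorphismProperty.monomorphisms SSet.{u}).rlp p
  rw [SSet.rlp_monomorphisms]
  rintro _ _ _ ⟨n⟩
  refine ⟨fun {f g} sq ↦ ?_⟩
  obtain _ | n := n
  · obtain ⟨x, hx⟩ := H₀ (SSet.yonedaEquiv g)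
    refine ⟨⟨{ l := SSet.yonedaEquiv.symm x, fac_left := SSet.boundary.hom_ext₀, fac_right := ?_ }⟩⟩
    rw [SSet.yonedaEquiv_symm_comp, hx, Equiv.symm_apply_apply]
  obtain ⟨x, hx, hb⟩ := H n (fun j _ ↦ SSet.yonedaEquiv (SSet.boundary.ι j ≫ f))
    (SSet.yonedaEquiv g) (by
      intro m φ ψ j k hj hk h
      rw [SSet.yonedaEquiv_naturality, SSet.yonedaEquiv_naturality, ← Category.assoc,
        ← Category.assoc]
      congr 2
      rw [← cancel_mono (Subfunctor.ι _), Category.assoc, Category.assoc, SSet.boundary.ι_ι,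
        SSet.boundary.ι_ι]
      refine ((SSet.stdSimplex.map_comp _ _).symm.trans ?_).trans (SSet.stdSimplex.map_comp _ _)
      rw [h]) (by
      intro j hj
      rw [← SSet.stdSimplex.yonedaEquiv_δ_comp, ← SSet.boundary.ι_ι j, Category.assoc, ← sq.w,
        ← Category.assoc]
      rfl)
  refine ⟨⟨{ l := SSet.yonedaEquiv.symm x, fac_left := ?_, fac_right := ?_ }⟩⟩
  · refine SSet.boundary.hom_ext fun j ↦ ?_
    rw [SSet.boundary.ι_ι_assoc, SSet.stdSimplex.δ_comp_yonedaEquiv_symm, hx j trivial,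
      Equiv.symm_apply_apply]
  · rw [SSet.yonedaEquiv_symm_comp, hb, Equiv.symm_apply_apply]

end Faces

lemma IsFaceFamily.map {X Y : SSet.{u}} {n : ℕ} {S : Fin (n + 2) → Prop} {y : ∀ j, S j → X _⦋n⦌}
    (hy : IsFaceFamily S y) (g : X ⟶ Y) : IsFaceFamily S (fun j hj ↦ g.app _ (y j hj)) := by
  intro m φ ψ j k hj hk h
  rw [← NatTrans.naturality_apply, ← NatTrans.naturality_apply, hy m φ ψ j k hj hk h]

lemma IsFaceFamily.mono {X : SSet.{u}} {n : ℕ} {S S' : Fin (n + 2) → Prop}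
    {y : ∀ j, S j → X _⦋n⦌} (hy : IsFaceFamily S y) (h : ∀ j, S' j → S j) :
    IsFaceFamily S' (fun j hj ↦ y j (h j hj)) :=
  fun m φ ψ j k _ _ e ↦ hy m φ ψ j k _ _ e

/-! ### Tuples of simplices -/

section Tuples

/-- The simplicial set whose `n`-simplices are the `(n + 1)`-tuples of `n`-simplices of `E`,
indexed by the vertices of `Δ[n]`. -/
@[reducible]
def tup (E : SSet.{u}) : SSet.{u} where
  obj n := Fin (n.unop.len + 1) → E.obj n
  map φ := ↾fun e l ↦ E.map φ (e (φ.unop.toOrderHom l))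
  map_id n := by
    ext e l
    exact Functor.map_id_apply E n _
  map_comp φ ψ := by
    ext e l
    exact Functor.map_comp_apply E φ ψ _

/-- The map on tuples induced by a map of simplicial sets. -/
@[simps]
def tupMap {E Y : SSet.{u}} (p : E ⟶ Y) : tup E ⟶ tup Y where
  app n := ↾fun e l ↦ p.app n (e l)
  naturality n m φ := by
    ext e l
    exact NatTrans.naturality_apply p φ _

variable {E Y : SSet.{u}} {n : ℕ}

/-- A horn of tuples has a filler at the vertex `i` of the horn. -/
lemma exists_vertex_filler (p : E ⟶ Y) [Fibration p] (i : Fin (n + 2))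
    (y : ∀ j, j ≠ i → (tup E) _⦋n⦌) (hy : IsFaceFamily (· ≠ i) y) (b : Y _⦋n + 1⦌)
    (hb : ∀ j hj q, j.succAbove q = i → p.app _ (y j hj q) = Y.δ j b) :
    ∃ x : E _⦋n + 1⦌, p.app _ x = b ∧ ∀ j hj q, j.succAbove q = i → E.δ j x = y j hj q := by
  choose v hv using fun (j : Fin (n + 2)) (hj : j ≠ i) ↦ Fin.exists_succAbove_eq hj.symm
  obtain ⟨x, hx, hx'⟩ := exists_filler p i (fun j hj ↦ y j hj (v j hj)) b (by
    intro m φ ψ j k hj hk q hq h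
    have hφ : φ.toOrderHom q = v j hj :=
      Fin.succAbove_right_injective (hq.trans (hv j hj).symm)
    have hψ : ψ.toOrderHom q = v k hk := by
      refine Fin.succAbove_right_injective (p := k) ((?_ : _ = i).trans (hv k hk).symm)
      rw [← hq]
      exact (DFunLike.congr_fun (congrArg SimplexCategory.Hom.toOrderHom h) q).symm
    have : E.map φ.op (y j hj (φ.toOrderHom q)) = E.map ψ.op (y k hk (ψ.toOrderHom q)) :=
      congr_fun (hy m φ ψ j k hj hk h) q
    rw [hφ, hψ] at this
    exact this) (fun j hj ↦ hb j hj _ (hv j hj))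
  refine ⟨x, hx', fun j hj q hq ↦ ?_⟩
  rw [hx j hj]
  congr 1
  exact Fin.succAbove_right_injective ((hv j hj).trans hq.symm)

/-- If `p` is a Kan fibration that is surjective on vertices, then its map on tuples is a trivial
fibration: to fill a boundary, one may choose the entries of the tuple independently of each other,
and the entry at the vertex `i` has to fill the horn opposite to the face that does not
contain `i`. -/
lemma trivFib_tupMap (p : E ⟶ Y) [Fibration p] (hp : ∀ b : Y _⦋0⦌, ∃ x, p.app _ x = b) :
    TrivFib (tupMap p) := by
  refine trivFib_of_filler _ (fun b ↦ ?_) (fun n y b hy hb ↦ ?_)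
  · choose x hx using fun l ↦ hp (b l)
    exact ⟨x, funext hx⟩
  · have H (i : Fin (n + 2)) := exists_vertex_filler p i (fun j _ ↦ y j trivial)
      (hy.mono (fun _ _ ↦ trivial)) (b i) (by
        intro j hj q hq
        refine (congr_fun (hb j trivial) q).trans ?_
        subst hq
        rfl)
    choose x hx hx' using H
    refine ⟨x, fun j hj ↦ funext fun q ↦ ?_, funext hx⟩
    exact hx' (j.succAbove q) j (Fin.succAbove_ne j q).symm q rfl

end Tuples

/-! ### Calculus in a simplicial groupoid -/

namespace SimplicialGroupoid

section Calculus

variable (G : SimplicialGroupoid.{u}) {n k : SimplexCategoryᵒᵖ}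

open Classical in
/-- The composite "first `f`, then `g`" as a total operation on arrows, with the junk value `f` if
`f` and `g` are not composable. -/
def mul (f g : G.ar.obj n) : G.ar.obj n :=
  if h : G.t.app n f = G.s.app n g then G.m.app n ⟨(f, g), h⟩ else f

variable {G} {f g k' : G.ar.obj n}

lemma mul_eq (h : G.t.app n f = G.s.app n g) : G.mul f g = G.m.app n ⟨(f, g), h⟩ := dif_pos h

lemma s_mul (h : G.t.app n f = G.s.app n g) : G.s.app n (G.mul f g) = G.s.app n f := by
  rw [mul_eq h]
  exact G.s_m _

lemma t_mul (h : G.t.app n f = G.s.app n g) : G.t.app n (G.mul f g) = G.t.app n g := by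
  rw [mul_eq h]
  exact G.t_m _

lemma mul_assoc (h : G.t.app n f = G.s.app n g) (h' : G.t.app n g = G.s.app n k') :
    G.mul (G.mul f g) k' = G.mul f (G.mul g k') := by
  rw [mul_eq ((t_mul h).trans h'), mul_eq (h.trans (s_mul h').symm)]
  simp only [mul_eq h, mul_eq h']
  exact G.assoc n f g k' h h' _ _

lemma e_mul {x : G.ob.obj n} (h : x = G.s.app n f) : G.mul (G.e.app n x) f = f := by
  subst h
  rw [mul_eq (G.t_e _)]
  exact G.id_comp n f _

lemma mul_e {x : G.ob.obj n} (h : G.t.app n f = x) : G.mul f (G.e.app n x) = f := by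
  subst h
  rw [mul_eq (G.s_e _).symm]
  exact G.comp_id n f _

lemma i_mul (f : G.ar.obj n) : G.mul (G.i.app n f) f = G.e.app n (G.t.app n f) := by
  rw [mul_eq (G.t_i f)]
  exact G.inv_comp n f _

lemma mul_i (f : G.ar.obj n) : G.mul f (G.i.app n f) = G.e.app n (G.s.app n f) := by
  rw [mul_eq (G.s_i f).symm]
  exact G.comp_inv n f _

lemma i_mul_mul (h : G.t.app n f = G.s.app n g) : G.mul (G.i.app n f) (G.mul f g) = g := by
  rw [← mul_assoc (G.t_i f) h, i_mul, e_mul h]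

lemma mul_i_mul (h : G.s.app n f = G.s.app n g) : G.mul f (G.mul (G.i.app n f) g) = g := by
  rw [← mul_assoc (G.s_i f).symm ((G.t_i f).trans h), mul_i, e_mul h]

lemma mul_i_mul_right (h : G.t.app n f = G.t.app n g) :
    G.mul (G.mul f (G.i.app n g)) g = f := by
  rw [mul_assoc (h.trans (G.s_i g).symm) (G.t_i g), i_mul, mul_e h]

lemma mul_left_cancel (h : G.t.app n f = G.s.app n g) (h' : G.t.app n f = G.s.app n k')
    (e : G.mul f g = G.mul f k') : g = k' := by
  rw [← i_mul_mul h, e, i_mul_mul h']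

lemma i_i (f : G.ar.obj n) : G.i.app n (G.i.app n f) = f := by
  have h : G.t.app n (G.i.app n f) = G.s.app n (G.i.app n (G.i.app n f)) := (G.s_i _).symm
  refine mul_left_cancel h (G.t_i f) ?_
  rw [mul_i, i_mul, s_i]

lemma i_e (x : G.ob.obj n) : G.i.app n (G.e.app n x) = G.e.app n x := by
  have h := i_mul (G.e.app n x)
  rwa [t_e, mul_e] at h
  rw [t_i, s_e]

lemma map_mul (φ : n ⟶ k) (h : G.t.app n f = G.s.app n g) :
    G.ar.map φ (G.mul f g) = G.mul (G.ar.map φ f) (G.ar.map φ g) := by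
  have h' : G.t.app k (G.ar.map φ f) = G.s.app k (G.ar.map φ g) := by
    rw [NatTrans.naturality_apply, NatTrans.naturality_apply, h]
  rw [mul_eq h, mul_eq h']
  exact (NatTrans.naturality_apply G.m φ ⟨(f, g), h⟩).symm

lemma map_i (φ : n ⟶ k) (f : G.ar.obj n) :
    G.ar.map φ (G.i.app n f) = G.i.app k (G.ar.map φ f) :=
  (NatTrans.naturality_apply G.i φ f).symm

lemma map_e (φ : n ⟶ k) (x : G.ob.obj n) :
    G.ar.map φ (G.e.app n x) = G.e.app k (G.ob.map φ x) :=
  (NatTrans.naturality_apply G.e φ x).symm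

lemma s_map (φ : n ⟶ k) (f : G.ar.obj n) :
    G.s.app k (G.ar.map φ f) = G.ob.map φ (G.s.app n f) :=
  NatTrans.naturality_apply G.s φ f

lemma t_map (φ : n ⟶ k) (f : G.ar.obj n) :
    G.t.app k (G.ar.map φ f) = G.ob.map φ (G.t.app n f) :=
  NatTrans.naturality_apply G.t φ f

lemma Hom.ar_mul {H : SimplicialGroupoid.{u}} (F : Hom G H)
    (h : G.t.app n f = G.s.app n g) :
    F.ar.app n (G.mul f g) = H.mul (F.ar.app n f) (F.ar.app n g) := by
  have h' : H.t.app n (F.ar.app n f) = H.s.app n (F.ar.app n g) := by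
    rw [F.t_ar, F.s_ar, h]
  rw [mul_eq h, mul_eq h']
  exact F.comm_m _ _ _ _ _

end Calculus

/-! ### The classifying space in terms of matrices of arrows -/

section Matrices

variable (G : SimplicialGroupoid.{u})

/-- The matrices `f` of arrows of `G_n`, indexed by pairs of vertices of `Δ[n]`, such that `f i j`
followed by `f j k` is `f i k`. -/
structure Mat (n : SimplexCategoryᵒᵖ) where
  /-- the entries -/
  arr : Fin (n.unop.len + 1) → Fin (n.unop.len + 1) → G.ar.obj n
  t_eq_s (i j k) : G.t.app n (arr i j) = G.s.app n (arr j k)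
  mul_arr (i j k) : G.mul (arr i j) (arr j k) = arr i k

variable {G} in
lemma Mat.ext' {n : SimplexCategoryᵒᵖ} {f g : G.Mat n} (h : ∀ i j, f.arr i j = g.arr i j) :
    f = g := by
  cases f
  cases g
  congr 1
  exact funext fun i ↦ funext fun j ↦ h i j

/-- The simplicial set of matrices of arrows. As `G_n` is a groupoid, a matrix in `G.Mat n` is the
same as a string of `n` arrows, so that this is a model of the classifying space `BG`. It is
symmetric in the vertices of `Δ[n]`. -/
@[reducible]
def W : SSet.{u} where
  obj n := G.Mat n
  map {n m} φ := ↾fun f ↦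
    { arr i j := G.ar.map φ (f.arr (φ.unop.toOrderHom i) (φ.unop.toOrderHom j))
      t_eq_s i j k := by rw [t_map, s_map, f.t_eq_s]
      mul_arr i j k := by rw [← map_mul φ (f.t_eq_s _ _ _), f.mul_arr] }
  map_id n := by
    ext f
    refine Mat.ext' fun i j ↦ ?_
    exact Functor.map_id_apply G.ar n _
  map_comp φ ψ := by
    ext f
    refine Mat.ext' fun i j ↦ ?_
    exact Functor.map_comp_apply G.ar φ ψ _

variable {G}

/-- The `n`-simplices of the model `W G` of `BG` by matrices map to tuples of objects. -/
def W.ob : G.W ⟶ tup G.ob where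
  app n := ↾fun f l ↦ G.s.app n (f.arr l l)
  naturality n m φ := by
    ext f l
    exact s_map φ _

namespace Mat

variable {n : SimplexCategoryᵒᵖ} (f : G.Mat n)

lemma s_apply (i j) : G.s.app n (f.arr i j) = W.ob.app n f i := by
  rw [← f.mul_arr i i j, s_mul (f.t_eq_s _ _ _)]
  rfl

lemma t_apply (i j) : G.t.app n (f.arr i j) = W.ob.app n f j := f.t_eq_s i j j

lemma diag_apply (i) : f.arr i i = G.e.app n (W.ob.app n f i) := by
  have h := i_mul_mul (f.t_eq_s i i i)
  rw [f.mul_arr, i_mul, t_apply] at h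
  exact h.symm

lemma i_apply (i j) : G.i.app n (f.arr i j) = f.arr j i := by
  have h := i_mul_mul (f.t_eq_s i j i)
  rw [f.mul_arr, diag_apply, mul_e] at h
  · exact h
  · rw [t_i, s_apply]

lemma eq_star (l i j) : f.arr i j = G.mul (G.i.app n (f.arr l i)) (f.arr l j) := by
  rw [i_apply, f.mul_arr]

/-- A matrix is determined by any of its rows. -/
lemma ext_row {f g : G.Mat n} (l) (h : ∀ j, f.arr l j = g.arr l j) : f = g := by
  refine Mat.ext' fun i j ↦ ?_
  rw [f.eq_star l, g.eq_star l, h, h]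

end Mat

/-- Conjugation: given a matrix `h` and arrows `e i` that start at the objects of `h`, the matrix
with entries `(e i)⁻¹ ≫ h i j ≫ e j`. -/
def Mat.twist {n : SimplexCategoryᵒᵖ} (h : G.Mat n) (e : (tup G.ar).obj n)
    (he : ∀ l, G.s.app n (e l) = W.ob.app n h l) : G.Mat n :=
  have h1 (i j) : G.t.app n (h.arr i j) = G.s.app n (e j) := by rw [h.t_apply, he]
  have h2 (i j) : G.t.app n (G.i.app n (e i)) = G.s.app n (G.mul (h.arr i j) (e j)) := by
    rw [t_i, he, s_mul (h1 i j), h.s_apply]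
  have h3 (i j) : G.t.app n (G.mul (h.arr i j) (e j)) = G.t.app n (e j) := t_mul (h1 i j)
  { arr i j := G.mul (G.i.app n (e i)) (G.mul (h.arr i j) (e j))
    t_eq_s i j k := by rw [t_mul (h2 _ _), h3, s_mul (h2 _ _), s_i]
    mul_arr i j k := by
      rw [mul_assoc (h2 _ _), mul_assoc (h1 _ _), mul_i_mul,
        ← mul_assoc (h.t_eq_s _ _ _) (h1 _ _), h.mul_arr]
      · rw [he, s_mul (h1 _ _), h.s_apply]
      · rw [s_mul (h2 _ _), s_i]
      · rw [h3, s_mul (h2 _ _), s_i] }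

variable (G) in
/-- The tuples of arrows with a common source. -/
structure Star (n : SimplexCategoryᵒᵖ) where
  /-- the entries -/
  arr : Fin (n.unop.len + 1) → G.ar.obj n
  s_eq (i j) : G.s.app n (arr i) = G.s.app n (arr j)

lemma Star.ext' {n : SimplexCategoryᵒᵖ} {f g : G.Star n} (h : ∀ i, f.arr i = g.arr i) :
    f = g := by
  cases f
  cases g
  congr 1
  exact funext h

variable (G) in
/-- The simplicial set of tuples of arrows with a common source. -/
@[reducible]
def stars : SSet.{u} where
  obj n := G.Star n
  map φ := ↾fun g ↦
    { arr i := G.ar.map φ (g.arr (φ.unop.toOrderHom i))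
      s_eq i j := by rw [s_map, s_map, g.s_eq] }
  map_id n := by
    ext f
    exact Star.ext' fun i ↦ Functor.map_id_apply G.ar n _
  map_comp φ ψ := by
    ext f
    exact Star.ext' fun i ↦ Functor.map_comp_apply G.ar φ ψ _

variable (G) in
/-- The matrix with entries `(g i)⁻¹ ≫ g j` of a tuple `g` of arrows with a common source. -/
def starMatrix : G.stars ⟶ G.W where
  app n := ↾fun g ↦
    have h (i j) : G.t.app n (G.i.app n (g.arr i)) = G.s.app n (g.arr j) := by rw [t_i, g.s_eq i j]
    { arr i j := G.mul (G.i.app n (g.arr i)) (g.arr j)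
      t_eq_s i j k := by rw [t_mul (h _ _), s_mul (h _ _), s_i]
      mul_arr i j k := by
        rw [mul_assoc (h _ _), mul_i_mul (g.s_eq _ _)]
        rw [s_mul (h _ _), s_i] }
  naturality n m φ := by
    ext g
    refine Mat.ext' fun i j ↦ ?_
    change G.mul (G.i.app m (G.ar.map φ _)) (G.ar.map φ _) =
      G.ar.map φ (G.mul (G.i.app n (g.arr _)) (g.arr _))
    rw [map_mul, map_i]
    rw [t_i, g.s_eq]

lemma starMatrix_apply {n : SimplexCategoryᵒᵖ} (g : G.stars.obj n) (i j) :
    (G.starMatrix.app n g).arr i j = G.mul (G.i.app n (g.arr i)) (g.arr j) := rfl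

/-- The map of matrices induced by a morphism of simplicial groupoids. -/
def Hom.W {H : SimplicialGroupoid.{u}} (F : Hom G H) : G.W ⟶ H.W where
  app n := ↾fun f ↦
    { arr i j := F.ar.app n (f.arr i j)
      t_eq_s i j k := by rw [F.t_ar, F.s_ar, f.t_eq_s]
      mul_arr i j k := by rw [← F.ar_mul (f.t_eq_s _ _ _), f.mul_arr] }
  naturality n m φ := by
    ext f
    refine Mat.ext' fun i j ↦ ?_
    exact NatTrans.naturality_apply F.ar φ _

end Matrices

/-! ### Strings of arrows and matrices of arrows -/

section Comparison

variable (G : SimplicialGroupoid.{u})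

/-- The arrows of a string that start at its first object. -/
def firstRow {n : SimplexCategoryᵒᵖ} (σ : ComposableArrows (G.Obj n) n.unop.len) :
    G.stars.obj n :=
  { arr j := (σ.map (homOfLE (Fin.zero_le j))).1
    s_eq i j := by
      rw [(σ.map (homOfLE (Fin.zero_le i))).2.1, (σ.map (homOfLE (Fin.zero_le j))).2.1] }

variable {G} in
lemma comp_val {n : SimplexCategoryᵒᵖ} {x y z : G.Obj n} (f : x ⟶ y) (g : y ⟶ z) :
    (f ≫ g).1 = G.mul f.1 g.1 := (mul_eq _).symm

variable {G} in
lemma starMatrix_firstRow {n : SimplexCategoryᵒᵖ} (σ : ComposableArrows (G.Obj n) n.unop.len)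
    {i j} (h : i ≤ j) : (G.starMatrix.app n (G.firstRow σ)).arr i j = (σ.map (homOfLE h)).1 := by
  rw [starMatrix_apply]
  have : (σ.map (homOfLE (Fin.zero_le j))).1 =
      G.mul (σ.map (homOfLE (Fin.zero_le i))).1 (σ.map (homOfLE h)).1 := by
    rw [← comp_val, ← Functor.map_comp]
    rfl
  change G.mul (G.i.app n (σ.map (homOfLE (Fin.zero_le i))).1)
    (σ.map (homOfLE (Fin.zero_le j))).1 = _
  rw [this, i_mul_mul]
  rw [(σ.map (homOfLE (Fin.zero_le i))).2.2, (σ.map (homOfLE h)).2.1]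

/-- The map from the classifying space to its model by matrices. -/
def toW : G.B ⟶ G.W where
  app n := ↾fun σ ↦ G.starMatrix.app n (G.firstRow σ)
  naturality n m φ := by
    ext σ
    refine Mat.ext_row (n := m) 0 fun j ↦ ?_
    refine (starMatrix_firstRow _ (Fin.zero_le j)).trans ?_
    change G.ar.map φ _ = G.ar.map φ _
    congr 1
    exact (starMatrix_firstRow σ (φ.unop.toOrderHom.monotone (Fin.zero_le j))).symm

lemma toW_apply {n : SimplexCategoryᵒᵖ} (σ : ComposableArrows (G.Obj n) n.unop.len)
    {i j} (h : i ≤ j) : (G.toW.app n σ).arr i j = (σ.map (homOfLE h)).1 :=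
  starMatrix_firstRow σ h

/-- The string of arrows of a matrix. -/
def ofW {n : SimplexCategoryᵒᵖ} (f : G.Mat n) : ComposableArrows (G.Obj n) n.unop.len where
  obj l := W.ob.app n f l
  map {i j} _ := ⟨f.arr i j, f.s_apply i j, f.t_apply i j⟩
  map_id i := Subtype.ext (f.diag_apply i)
  map_comp {i j k} _ _ := Subtype.ext ((f.mul_arr i j k).symm.trans (mul_eq _))

variable {G} in
lemma eq_of_starMatrix_firstRow_eq {n : SimplexCategoryᵒᵖ}
    {σ τ : ComposableArrows (G.Obj n) n.unop.len}
    (h : G.starMatrix.app n (G.firstRow σ) = G.starMatrix.app n (G.firstRow τ)) : σ = τ := by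
  have h' {i j} (hij : i ≤ j) : (σ.map (homOfLE hij)).1 = (τ.map (homOfLE hij)).1 := by
    rw [← starMatrix_firstRow σ hij, ← starMatrix_firstRow τ hij, h]
  refine G.functor_ext (fun x ↦ ?_) (fun {x y} f ↦ h' (leOfHom f))
  exact (σ.map (𝟙 x)).2.1.symm.trans ((congrArg (G.s.app n) (h' le_rfl)).trans (τ.map (𝟙 x)).2.1)

lemma toW_bijective (n : SimplexCategoryᵒᵖ) : Function.Bijective (G.toW.app n) := by
  constructor
  · intro σ τ h
    exact eq_of_starMatrix_firstRow_eq h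
  · intro f
    refine ⟨G.ofW f, Mat.ext_row 0 fun j ↦ ?_⟩
    exact G.toW_apply (G.ofW f) (Fin.zero_le j)

instance : IsIso G.toW := by
  have (n : SimplexCategoryᵒᵖ) : IsIso (G.toW.app n) :=
    (isIso_iff_bijective _).2 (G.toW_bijective n)
  exact NatIso.isIso_of_isIso_app _

variable {G} in
lemma Hom.B_toW {H : SimplicialGroupoid.{u}} (F : Hom G H) : F.B ≫ H.toW = G.toW ≫ F.W := by
  ext n σ
  refine Mat.ext_row (n := n) 0 fun j ↦ ?_
  refine (H.toW_apply _ (Fin.zero_le j)).trans ?_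
  exact congrArg (F.ar.app n) (G.toW_apply σ (Fin.zero_le j)).symm

end Comparison

end SimplicialGroupoid

/-! ### Kan complexes and trivial fibrations -/

section Kan

instance (n : SimplexCategoryᵒᵖ) : Subsingleton ((⊤_ SSet.{u}).obj n) :=
  ⟨fun _ _ ↦ SSet.yonedaEquiv.symm.injective (Subsingleton.elim (α := _ ⟶ ⊤_ SSet.{u}) _ _)⟩

lemma TrivFib.fibration {X Y : SSet.{u}} {p : X ⟶ Y} (hp : TrivFib p) : Fibration p := by
  rw [SSet.modelCategoryQuillen.fibration_iff]
  exact MorphismProperty.antitone_rlp SSet.modelCategoryQuillen.J_le_monomorphisms _ hp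

lemma kanComplex_of_filler {X : SSet.{u}}
    (H : ∀ (n : ℕ) (i : Fin (n + 2)) (y : ∀ j, j ≠ i → X _⦋n⦌), IsFaceFamily (· ≠ i) y →
      ∃ x : X _⦋n + 1⦌, ∀ j hj, X.δ j x = y j hj) : SSet.KanComplex X := by
  refine (isFibrant_iff _).2 (fibration_of_filler _ fun n i y b hy _ ↦ ?_)
  obtain ⟨x, hx⟩ := H n i y hy
  exact ⟨x, hx, Subsingleton.elim _ _⟩

lemma exists_vertex_filler_of_kanComplex {E : SSet.{u}} [SSet.KanComplex E] {n : ℕ}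
    (i : Fin (n + 2)) (y : ∀ j, j ≠ i → (tup E) _⦋n⦌) (hy : IsFaceFamily (· ≠ i) y) :
    ∃ x : E _⦋n + 1⦌, ∀ j hj q, j.succAbove q = i → E.δ j x = y j hj q := by
  have h : Fibration (Limits.terminal.from E) := (isFibrant_iff _).1 inferInstance
  obtain ⟨x, -, hx⟩ := exists_vertex_filler (Limits.terminal.from E) i y hy
    (SSet.yonedaEquiv (Limits.terminal.from (Δ[n + 1] : SSet.{u})))
    (fun _ _ _ _ ↦ Subsingleton.elim _ _)
  exact ⟨x, hx⟩

end Kan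

namespace SimplicialGroupoid

variable {G : SimplicialGroupoid.{u}}

/-! ### The classifying space is a Kan complex -/

section KanComplex

/-- The common source of the arrows of a star. -/
def stars.source : G.stars ⟶ G.ob where
  app n := ↾fun g ↦ G.s.app n (g.arr 0)
  naturality n m φ := by
    ext g
    exact (s_map φ _).trans (congrArg (G.ob.map φ) (g.s_eq _ _))

/-- The underlying tuple of a star. -/
def stars.toTup : G.stars ⟶ tup G.ar where
  app n := ↾fun g ↦ g.arr

/-- The constant tuples. -/
@[simps]
def tupDiag (E : SSet.{u}) : E ⟶ tup E where
  app n := ↾fun x _ ↦ x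

/-- A star over `x` is a lift of the constant tuple of `x` along the map on tuples of the source
map. -/
lemma trivFib_stars_source [Fibration G.s] : TrivFib (stars.source (G := G)) := by
  intro A B i hi
  refine ⟨fun {f g} sq ↦ ?_⟩
  have hT := trivFib_tupMap G.s (fun x ↦ ⟨_, G.s_e x⟩) i hi
  have sq' : CommSq (f ≫ stars.toTup) i (tupMap G.s) (g ≫ tupDiag G.ob) := ⟨by
    ext n a l
    exact ((f.app n a).s_eq l 0).trans (ConcreteCategory.congr_hom (congr_app sq.w n) a)⟩
  have hl (n : SimplexCategoryᵒᵖ) (b : B.obj n) (l) : G.s.app n (sq'.lift.app n b l) = g.app n b :=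
    congr_fun (ConcreteCategory.congr_hom (congr_app sq'.fac_right n) b) l
  refine ⟨⟨{ l :=
    { app n := ↾fun b ↦
        { arr := sq'.lift.app n b
          s_eq i j := by rw [hl, hl] }
      naturality n m φ := by
        ext b
        refine Star.ext' fun l ↦ ?_
        exact congr_fun (NatTrans.naturality_apply sq'.lift φ b) l }
             fac_left := ?_
             fac_right := ?_ }⟩⟩
  · ext n a
    refine Star.ext' fun l ↦ ?_
    exact congr_fun (ConcreteCategory.congr_hom (congr_app sq'.fac_left n) a) l
  · ext n b
    exact hl n b 0

/-- The rows of a matrix. -/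
def W.rows : G.W ⟶ tup G.stars where
  app n := ↾fun f i ↦ { arr := f.arr i, s_eq j k := by rw [f.s_apply, f.s_apply] }

lemma starMatrix_rows {n : SimplexCategoryᵒᵖ} (f : G.Mat n) (i) :
    G.starMatrix.app n (W.rows.app n f i) = f :=
  Mat.ext' fun j k ↦ (f.eq_star i j k).symm

/-- In a horn of matrices at the vertex `i`, the rows at `i` of the faces are the entries of a horn
in the Kan complex of stars, and a filler of that horn is the row at `i` of a filler. -/
theorem kanComplex_W [SSet.KanComplex G.ob] [Fibration G.s] : SSet.KanComplex G.W := by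
  have := (trivFib_stars_source (G := G)).fibration
  have : SSet.KanComplex G.stars := isFibrant_of_fibration (stars.source (G := G))
  refine kanComplex_of_filler fun n i y hy ↦ ?_
  obtain ⟨x, hx⟩ := exists_vertex_filler_of_kanComplex i _ (hy.map W.rows)
  refine ⟨G.starMatrix.app _ x, fun j hj ↦ ?_⟩
  obtain ⟨q, hq⟩ := Fin.exists_succAbove_eq hj.symm
  refine (NatTrans.naturality_apply G.starMatrix (SimplexCategory.δ j).op x).symm.trans ?_
  refine (congrArg (G.starMatrix.app _) (hx j hj q hq)).trans ?_
  exact starMatrix_rows _ _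

theorem kanComplex_B [SSet.KanComplex G.ob] [Fibration G.s] : SSet.KanComplex G.B := by
  have := kanComplex_W (G := G)
  exact isFibrant_of_fibration G.toW

end KanComplex

/-! ### Action groupoids -/

section Action

variable {X : SSet.{u}} {π : X ⟶ G.ob} (A : LeftAction G π)

lemma LeftAction.ar_ext {n : SimplexCategoryᵒᵖ} {p q : A.actionGroupoid.ar.obj n}
    (h : A.proj.ar.app n p = A.proj.ar.app n q)
    (h' : A.actionGroupoid.s.app n p = A.actionGroupoid.s.app n q) : p = q :=
  Subtype.ext (Prod.ext h h')

/-- The arrow `(g, x)` of the action groupoid. -/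
def LeftAction.arrowOf {n : SimplexCategoryᵒᵖ} (g : G.ar.obj n) (x : X.obj n)
    (h : G.s.app n g = π.app n x) : A.actionGroupoid.ar.obj n := ⟨(g, x), h⟩

lemma LeftAction.t_arrowOf_mul {n : SimplexCategoryᵒᵖ} (g g' : G.ar.obj n) (x x' : X.obj n)
    (h : G.s.app n g = π.app n x) (h' : G.s.app n g' = π.app n x')
    (hx : A.actionGroupoid.t.app n (A.arrowOf g x h) = x') (hg : G.t.app n g = G.s.app n g') :
    A.actionGroupoid.t.app n (A.arrowOf g' x' h') =
      A.actionGroupoid.t.app n (A.arrowOf (G.mul g g') x ((s_mul hg).trans h)) := by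
  subst hx
  simp only [mul_eq hg]
  exact (A.comp_act n g g' x h hg _ h').symm

/-- A simplex of the classifying space of the action groupoid is a matrix of arrows of `G` with a
point of `X` over one of its objects, since the action transports this point to the
other objects. -/
theorem fibration_proj_W [Fibration π] : Fibration A.proj.W := by
  refine fibration_of_filler _ fun n i y b hy hb ↦ ?_
  obtain ⟨x, hx, hx'⟩ := exists_vertex_filler π i _ (hy.map W.ob) (W.ob.app _ b i) (by
    rintro j hj q rfl
    refine (A.proj.s_ar _).symm.trans ?_
    exact (congrArg (fun f : G.Mat _ ↦ W.ob.app _ f q) (hb j hj)).trans (s_map _ _))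
  have h1 (j) : G.s.app _ (b.arr i j) = π.app _ x := (b.s_apply i j).trans hx.symm
  -- the transport of `x` along the arrow from the vertex `i` to the vertex `j`
  let z (j) := A.actionGroupoid.t.app _ (A.arrowOf (b.arr i j) x (h1 j))
  have hz (j) : π.app _ (z j) = W.ob.app _ b j := (A.π_act _).trans (b.t_apply i j)
  have h2 (j k) : G.s.app _ (b.arr j k) = π.app _ (z j) := (b.s_apply j k).trans (hz j).symm
  have h3 (j k) : A.actionGroupoid.t.app _ (A.arrowOf (b.arr j k) (z j) (h2 j k)) = z k := by
    refine (A.t_arrowOf_mul _ _ _ _ (h1 j) (h2 j k) rfl (b.t_eq_s i j k)).trans ?_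
    simp only [b.mul_arr]
    rfl
  refine ⟨{ arr j k := A.arrowOf (b.arr j k) (z j) (h2 j k), t_eq_s := fun j k _ ↦ h3 j k,
            mul_arr := fun j k l ↦ ?_ }, fun j hj ↦ ?_, ?_⟩
  · have h4 : A.actionGroupoid.t.app _ (A.arrowOf (b.arr j k) (z j) (h2 j k)) =
      A.actionGroupoid.s.app _ (A.arrowOf (b.arr k l) (z k) (h2 k l)) := h3 j k
    refine A.ar_ext ?_ ?_
    · rw [A.proj.ar_mul h4]
      exact b.mul_arr j k l
    · exact s_mul h4
  · obtain ⟨q, rfl⟩ := Fin.exists_succAbove_eq hj.symm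
    refine Mat.ext' fun k l ↦ A.ar_ext ?_ ?_
    · exact (congrArg (fun f : G.Mat _ ↦ f.arr k l) (hb j hj)).symm
    · refine Eq.trans ?_ (((y j hj).t_apply q k).trans ((y j hj).s_apply k l).symm)
      refine (t_map (G := A.actionGroupoid) (SimplexCategory.δ j).op _).symm.trans ?_
      refine congrArg (A.actionGroupoid.t.app _) (A.ar_ext ?_ ?_)
      · exact (congrArg (fun f : G.Mat _ ↦ f.arr q k) (hb j hj)).symm
      · exact (hx' j hj q rfl).trans ((y j hj).s_apply q k).symm
  · exact Mat.ext' fun j k ↦ rfl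

theorem fibration_proj_B [Fibration π] : Fibration A.proj.B := by
  have := fibration_proj_W A
  have h : Fibration (A.proj.B ≫ G.toW) := by
    rw [Hom.B_toW]
    infer_instance
  have e : A.proj.B = (A.proj.B ≫ G.toW) ≫ inv G.toW := by simp
  rw [e]
  infer_instance

end Action

/-! ### Transitive groupoids -/

section Transitive

/-- The composite `δ j`, `σ a`, `δ r` avoids the vertex `j` if `δ r` is a section of `σ a` and `j`
is neither of the two vertices that `σ a` identifies. -/
lemma succAbove_predAbove_succAbove_ne {n : ℕ} {a : Fin (n + 1)} {j r : Fin (n + 2)}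
    (hr : r = a.castSucc ∨ r = a.succ) (h1 : j ≠ a.castSucc) (h2 : j ≠ a.succ) (l : Fin (n + 1)) :
    r.succAbove (a.predAbove (j.succAbove l)) ≠ j := by
  have hs {n : ℕ} (j : Fin (n + 2)) (l : Fin (n + 1)) :
      (j.succAbove l).1 = if l.1 < j.1 then l.1 else l.1 + 1 := by
    unfold Fin.succAbove
    simp only [Fin.lt_def, Fin.val_castSucc]
    split_ifs <;> rfl
  have hp (m : Fin (n + 2)) : (a.predAbove m).1 = if a.1 < m.1 then m.1 - 1 else m.1 := by
    unfold Fin.predAbove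
    simp only [Fin.lt_def, Fin.val_castSucc]
    split_ifs <;> rfl
  rw [Ne, Fin.ext_iff] at h1 h2 ⊢
  rw [hs, hp, hs]
  simp only [Fin.val_castSucc, Fin.val_succ, Fin.ext_iff] at hr h1 h2
  split_ifs <;> omega

/-- An arrow `w` of `G_{n + 1}` can be changed so that its face opposite to `r` becomes a given
arrow `y` with the same ends. The `j`-th face of `w` remains unchanged if the degeneracies `σ a` of
`y` and of the face of `w` opposite to `r` have the same `j`-th face. -/
lemma exists_correction
    (hG : ∀ n (x x' : G.ob.obj n), ∃ f, G.s.app n f = x ∧ G.t.app n f = x')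
    {n : ℕ} (w : G.ar _⦋n + 1⦌) (r : Fin (n + 2)) (a : Fin (n + 1))
    (ha : SimplexCategory.δ r ≫ SimplexCategory.σ a = 𝟙 _) (y : G.ar _⦋n⦌)
    (hs : G.s.app _ y = G.s.app _ (G.ar.map (SimplexCategory.δ r).op w))
    (ht : G.t.app _ y = G.t.app _ (G.ar.map (SimplexCategory.δ r).op w)) :
    ∃ w' : G.ar _⦋n + 1⦌, G.s.app _ w' = G.s.app _ w ∧ G.t.app _ w' = G.t.app _ w ∧
      G.ar.map (SimplexCategory.δ r).op w' = y ∧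
      ∀ j : Fin (n + 2), G.ar.map (SimplexCategory.δ j ≫ SimplexCategory.σ a).op y =
          G.ar.map (SimplexCategory.δ j ≫ SimplexCategory.σ a).op
            (G.ar.map (SimplexCategory.δ r).op w) →
        G.ar.map (SimplexCategory.δ j).op w' = G.ar.map (SimplexCategory.δ j).op w := by
  set d := (SimplexCategory.δ r).op
  set σ := (SimplexCategory.σ a).op
  have hdσ {X : SSet.{u}} (x : X _⦋n⦌) : X.map d (X.map σ x) = x := by
    rw [← Functor.map_comp_apply, ← op_comp, ha]
    exact Functor.map_id_apply X _ x
  set x := G.s.app _ w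
  -- `z` is the difference between `y` and the face of `w`
  obtain ⟨z, hz⟩ : ∃ z, z = G.mul y (G.i.app _ (G.ar.map d w)) := ⟨_, rfl⟩
  have hyw : G.t.app _ y = G.s.app _ (G.i.app _ (G.ar.map d w)) := by rw [s_i, ht]
  have hzs : G.s.app _ z = G.ob.map d x := by rw [hz, s_mul hyw, hs, s_map]
  have hzt : G.t.app _ z = G.ob.map d x := by rw [hz, t_mul hyw, t_i, s_map]
  obtain ⟨v', hv's, hv't⟩ := hG _ x (G.ob.map σ (G.ob.map d x))
  -- `v` is an arrow from `x` to its degenerate copy whose face opposite to `r` is an identity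
  obtain ⟨v, hv⟩ : ∃ v, v = G.mul v' (G.i.app _ (G.ar.map σ (G.ar.map d v'))) := ⟨_, rfl⟩
  have hvc : G.t.app _ v' = G.s.app _ (G.i.app _ (G.ar.map σ (G.ar.map d v'))) := by
    rw [s_i, t_map, t_map, hv't, hdσ]
  have hvs : G.s.app _ v = x := by rw [hv, s_mul hvc, hv's]
  have hvt : G.t.app _ v = G.ob.map σ (G.ob.map d x) := by
    rw [hv, t_mul hvc, t_i, s_map, s_map, hv's]
  have hvd : G.ar.map d v = G.e.app _ (G.ob.map d x) := by
    rw [hv, map_mul _ hvc, map_i, hdσ, mul_i, s_map, hv's]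
  have c1 : G.t.app _ v = G.s.app _ (G.ar.map σ z) := by rw [hvt, s_map, hzs]
  have c2 : G.t.app _ (G.mul v (G.ar.map σ z)) = G.s.app _ (G.i.app _ v) := by
    rw [t_mul c1, t_map, hzt, s_i, hvt]
  have c3 : G.t.app _ (G.mul (G.mul v (G.ar.map σ z)) (G.i.app _ v)) = G.s.app _ w := by
    rw [t_mul c2, t_i, hvs]
  -- the degeneracy of `z` is conjugated by `v`, so that it can be composed with `w`
  refine ⟨G.mul (G.mul (G.mul v (G.ar.map σ z)) (G.i.app _ v)) w, ?_, ?_, ?_, fun j hj ↦ ?_⟩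
  · rw [s_mul c3, s_mul c2, s_mul c1, hvs]
  · rw [t_mul c3]
  · rw [map_mul _ c3, map_mul _ c2, map_mul _ c1, map_i, hvd, hdσ, e_mul hzs.symm, i_e, mul_e hzt,
      hz, mul_i_mul_right ht]
  · have hz' : G.ar.map (SimplexCategory.δ j).op (G.ar.map σ z) =
        G.e.app _ (G.ob.map (SimplexCategory.δ j).op (G.ob.map σ (G.ob.map d x))) := by
      rw [map_comp_apply, map_comp_apply] at hj
      rw [hz, map_mul _ hyw, map_mul _ (by rw [t_map, s_map, hyw]), hj, map_i, map_i, mul_i,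
        s_map, s_map, s_map]
    rw [map_mul _ c3, map_mul _ c2, map_mul _ c1, hz', mul_e, map_i, mul_i, e_mul]
    · rw [s_map, hvs, s_map]
    · rw [t_map, hvt]

/-- Moore's theorem that simplicial groups are Kan complexes, in the relative form for a simplicial
groupoid all of whose groupoids `G_n` are transitive. A horn is filled by correcting an arbitrary
arrow between the given end points face by face, the faces before `i` in increasing order and those
after `i` in decreasing order. -/
theorem fibration_lift_s_t
    (hG : ∀ n (x x' : G.ob.obj n), ∃ f, G.s.app n f = x ∧ G.t.app n f = x') :
    Fibration (CartesianMonoidalCategory.lift G.s G.t) := by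
  refine fibration_of_filler _ fun n i y b hy hb ↦ ?_
  have hbs (j hj) : G.s.app _ (y j hj) = G.ob.map (SimplexCategory.δ j).op b.1 :=
    congrArg Prod.fst (hb j hj)
  have hbt (j hj) : G.t.app _ (y j hj) = G.ob.map (SimplexCategory.δ j).op b.2 :=
    congrArg Prod.snd (hb j hj)
  let P (S : Fin (n + 2) → Prop) : Prop := ∃ w : G.ar _⦋n + 1⦌, G.s.app _ w = b.1 ∧
    G.t.app _ w = b.2 ∧ ∀ j hj, S j → G.ar.map (SimplexCategory.δ j).op w = y j hj
  -- `P S` says that the faces in `S` can be made right; a step adds the face `r` to `S`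
  have step (S S' : Fin (n + 2) → Prop) (r : Fin (n + 2)) (hr : r ≠ i) (a : Fin (n + 1))
      (har : r = a.castSucc ∨ r = a.succ) (hS : ∀ j, S j → j ≠ a.castSucc ∧ j ≠ a.succ)
      (hS' : ∀ j, j ≠ i → S' j → S j ∨ j = r) (h : P S) : P S' := by
    obtain ⟨w, hw1, hw2, hw3⟩ := h
    obtain ⟨w', hw1', hw2', hw3', hw4'⟩ := exists_correction hG w r a (by
      rcases har with rfl | rfl
      · exact SimplexCategory.δ_comp_σ_self
      · exact SimplexCategory.δ_comp_σ_succ) (y r hr) (by rw [hbs, s_map, hw1])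
      (by rw [hbt, t_map, hw2])
    refine ⟨w', hw1'.trans hw1, hw2'.trans hw2, fun j hj hj' ↦ ?_⟩
    rcases hS' j hj hj' with hj' | rfl
    -- the part of the face `r` that is relevant for the face `j` lies in the face `j`, where `w` is
    -- already right
    · rw [← hw3 j hj hj']
      obtain ⟨h1, h2⟩ := hS j hj'
      apply hw4'
      obtain ⟨ψ, hψ⟩ := SimplexCategory.eq_comp_δ_of_not_surjective'
        ((SimplexCategory.δ j ≫ SimplexCategory.σ a) ≫ SimplexCategory.δ r) j (by
        intro l hl
        change r.succAbove (a.predAbove (j.succAbove l)) = j at hl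
        exact succAbove_predAbove_succAbove_ne har h1 h2 l hl)
      rw [hy _ _ _ r j hr hj hψ, ← hw3 j hj hj', ← map_comp_apply, ← map_comp_apply, hψ]
    · exact hw3'
  have up (r : ℕ) (hr : r ≤ i) : P (fun j ↦ j.1 < r) := by
    induction r with
    | zero =>
      obtain ⟨w, hw1, hw2⟩ := hG _ b.1 b.2
      exact ⟨w, hw1, hw2, fun j hj h ↦ by simp at h⟩
    | succ r ih =>
      refine step _ _ ⟨r, by omega⟩ (fun h ↦ by simp [← h] at hr) ⟨r, by omega⟩ (Or.inl rfl) ?_ ?_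
        (ih (by omega))
      · rintro j hj
        constructor <;> (rintro rfl; simp at hj)
      · rintro j - hj
        have : j.1 < r ∨ j.1 = r := by omega
        exact this.imp id (fun h ↦ Fin.ext h)
  have down (r : ℕ) (hr : r + i ≤ n + 1) : P (fun j ↦ j.1 < i.1 ∨ n + 2 ≤ j.1 + r) := by
    induction r with
    | zero =>
      obtain ⟨w, hw1, hw2, hw3⟩ := up i le_rfl
      exact ⟨w, hw1, hw2, fun j hj h ↦ hw3 j hj (by omega)⟩
    | succ r ih =>
      refine step _ _ ⟨n + 1 - r, by omega⟩ ?_ ⟨n - r, by omega⟩ (Or.inr ?_) ?_ ?_ (ih (by omega))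
      · intro h
        have := congrArg Fin.val h
        simp at this
        omega
      · ext
        simp
        omega
      · rintro j hj
        constructor <;> (rintro rfl; simp at hj; omega)
      · rintro j hji hj
        have : (j.1 < i.1 ∨ n + 2 ≤ j.1 + r) ∨ j.1 = n + 1 - r := by omega
        exact this.imp id (fun h ↦ Fin.ext h)
  obtain ⟨w, hw1, hw2, hw3⟩ := down (n + 1 - i) (by omega)
  refine ⟨w, fun j hj ↦ hw3 j hj ?_, Prod.ext hw1 hw2⟩
  have : j.1 ≠ i.1 := fun h ↦ hj (Fin.ext h)
  omega

end Transitive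

end SimplicialGroupoid

/-! ### Paths with prescribed ends -/

section Paths

variable {X Y E Z : SSet.{u}}

/-- The inclusion `X ⟶ Δ[1] ⊗ X` of the end `v` of the cylinder. -/
abbrev cylEnd (v : Fin 2) (X : SSet.{u}) : X ⟶ Δ[1] ⊗ X :=
  CartesianMonoidalCategory.lift (SSet.const (SSet.stdSimplex.obj₀Equiv.symm v)) (𝟙 X)

/-- The value at the vertex `l` of a simplex of `Δ[1]`. -/
abbrev val {n : SimplexCategoryᵒᵖ} (α : (Δ[1] : SSet.{u}).obj n) (l : Fin (n.unop.len + 1)) :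
    Fin 2 := (SSet.stdSimplex.objEquiv α).toOrderHom l

lemma ext_val {n : SimplexCategoryᵒᵖ} {α β : (Δ[1] : SSet.{u}).obj n}
    (h : ∀ l, val α l = val β l) : α = β :=
  SSet.stdSimplex.objEquiv.injective (SimplexCategory.Hom.ext _ _ (OrderHom.ext _ _ (funext h)))

lemma eq_cylEnd {n : SimplexCategoryᵒᵖ} (v : Fin 2) (α : (Δ[1] : SSet.{u}).obj n) (x : X.obj n)
    (h : ∀ l, val α l = v) : ((α, x) : (Δ[1] ⊗ X).obj n) = (cylEnd v X).app n x :=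
  Prod.ext (ext_val h) rfl

lemma val_of_mem_boundary {n : SimplexCategoryᵒᵖ} (α : (Δ[1] : SSet.{u}).obj n)
    (h : α ∈ (SSet.boundary 1).obj n) (l) : val α l = val α 0 := by
  by_contra hl
  refine h fun v ↦ ?_
  by_cases hv : val α 0 = v
  · exact ⟨0, hv⟩
  · refine ⟨l, show val α l = v from ?_⟩
    omega

lemma val_of_mem_horn {n : SimplexCategoryᵒᵖ} (v : Fin 2) (α : (Δ[1] : SSet.{u}).obj n)
    (h : α ∈ (SSet.horn 1 v).obj n) (l) : val α l = v := by
  by_contra hl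
  refine h ?_
  rw [Set.eq_univ_iff_forall]
  intro w
  by_cases hw : w = v
  · exact Or.inr hw
  · refine Or.inl ⟨l, show val α l = w from ?_⟩
    omega

/-- Two maps `z 0` and `z 1` define a map on `S ⊗ X` if `S` is a subcomplex of `Δ[1]` that
consists of vertices. -/
def ofEnds (S : (Δ[1] : SSet.{u}).Subcomplex)
    (hS : ∀ (n : SimplexCategoryᵒᵖ) (α : (Δ[1] : SSet.{u}).obj n), α ∈ S.obj n →
      ∀ l, val α l = val α 0) (z : Fin 2 → (X ⟶ E)) : (S : SSet.{u}) ⊗ X ⟶ E where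
  app n := ↾fun p ↦ (z (val p.1.1 0)).app n p.2
  naturality n m φ := by
    ext p
    change (z (val p.1.1 (φ.unop.toOrderHom 0))).app m (X.map φ p.2) =
      E.map φ ((z (val p.1.1 0)).app n p.2)
    rw [hS n p.1.1 p.1.2, NatTrans.naturality_apply]

/-- If `S ⊗ X ∪ Δ[1] ⊗ A ⟶ Δ[1] ⊗ X` lifts against `q`, where `S` consists of the vertices of
`Δ[1]` that are in `V`, then paths whose ends in `V` are prescribed can be lifted along `q`
relatively to `A`. -/
lemma exists_path_lift_of_hasLiftingProperty (S : (Δ[1] : SSet.{u}).Subcomplex) (V : Set (Fin 2))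
    (hS : ∀ (n : SimplexCategoryᵒᵖ) (α : (Δ[1] : SSet.{u}).obj n), α ∈ S.obj n →
      ∀ l, val α l = val α 0)
    (hV : ∀ (n : SimplexCategoryᵒᵖ) (α : (Δ[1] : SSet.{u}).obj n), α ∈ S.obj n → val α 0 ∈ V)
    (hV' : ∀ v ∈ V, SSet.stdSimplex.obj₀Equiv.symm v ∈ S.obj (op ⦋0⦌))
    (A : X.Subcomplex) (q : E ⟶ Z) [HasLiftingProperty (S.unionProd A).ι q]
    (a : Δ[1] ⊗ (A : SSet.{u}) ⟶ E) (z : Fin 2 → (X ⟶ E)) (c : Δ[1] ⊗ X ⟶ Z)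
    (haz : ∀ v ∈ V, cylEnd v _ ≫ a = A.ι ≫ z v) (hac : Δ[1] ◁ A.ι ≫ c = a ≫ q)
    (hzc : ∀ v ∈ V, cylEnd v X ≫ c = z v ≫ q) :
    ∃ l : Δ[1] ⊗ X ⟶ E, Δ[1] ◁ A.ι ≫ l = a ∧ (∀ v ∈ V, cylEnd v X ≫ l = z v) ∧ l ≫ q = c := by
  let f : (S.unionProd A : SSet.{u}) ⟶ E :=
    (SSet.Subcomplex.unionProd.isPushout S A).desc a (ofEnds S hS z) (by
      ext n ⟨⟨α, hα⟩, x⟩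
      refine (congrArg (a.app n) (eq_cylEnd (val α 0) α x (hS n α hα))).trans ?_
      exact ConcreteCategory.congr_hom (congr_app (haz _ (hV n α hα)) n) x)
  have sq : CommSq f (S.unionProd A).ι q c := ⟨by
    refine (SSet.Subcomplex.unionProd.isPushout S A).hom_ext ?_ ?_
    · rw [IsPushout.inl_desc_assoc, SSet.Subcomplex.unionProd.ι₁_ι_assoc, hac]
    · rw [IsPushout.inr_desc_assoc, SSet.Subcomplex.unionProd.ι₂_ι_assoc]
      ext n ⟨⟨α, hα⟩, x⟩
      refine ((ConcreteCategory.congr_hom (congr_app (hzc _ (hV n α hα)) n) x)).symm.trans ?_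
      exact congrArg (c.app n) (eq_cylEnd (val α 0) α x (hS n α hα)).symm⟩
  refine ⟨sq.lift, ?_, fun v hv ↦ ?_, sq.fac_right⟩
  · rw [← SSet.Subcomplex.unionProd.ι₁_ι S A, Category.assoc, sq.fac_left, IsPushout.inl_desc]
  · have h1 : S.ι ▷ X ≫ sq.lift = ofEnds S hS z := by
      rw [← SSet.Subcomplex.unionProd.ι₂_ι S A, Category.assoc, sq.fac_left, IsPushout.inr_desc]
    ext n x
    let p : ((S : SSet.{u}) ⊗ X).obj n := (⟨_, S.map (n.unop.const _ 0).op (hV' v hv)⟩, x)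
    exact ConcreteCategory.congr_hom (congr_app h1 n) p

/-- Along a trivial fibration, paths with prescribed ends can be lifted relatively to a
subcomplex. -/
lemma TrivFib.exists_path_lift {q : E ⟶ Z} (hq : TrivFib q) (A : X.Subcomplex)
    (a : Δ[1] ⊗ (A : SSet.{u}) ⟶ E) (z : Fin 2 → (X ⟶ E)) (c : Δ[1] ⊗ X ⟶ Z)
    (haz : ∀ v, cylEnd v _ ≫ a = A.ι ≫ z v) (hac : Δ[1] ◁ A.ι ≫ c = a ≫ q)
    (hzc : ∀ v, cylEnd v X ≫ c = z v ≫ q) :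
    ∃ l : Δ[1] ⊗ X ⟶ E, Δ[1] ◁ A.ι ≫ l = a ∧ (∀ v, cylEnd v X ≫ l = z v) ∧ l ≫ q = c := by
  have := hq ((SSet.boundary 1).unionProd A).ι
    (by rw [MorphismProperty.monomorphisms.iff]; infer_instance)
  obtain ⟨l, h1, h2, h3⟩ := exists_path_lift_of_hasLiftingProperty (SSet.boundary 1) Set.univ
    (fun n α h ↦ val_of_mem_boundary α h) (fun _ _ _ ↦ trivial)
    (fun v _ ↦ by rw [SSet.boundary_obj_eq_univ 0 1]; trivial) A q a z c (fun v _ ↦ haz v) hac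
    (fun v _ ↦ hzc v)
  exact ⟨l, h1, fun v ↦ h2 v trivial, h3⟩

/-- Along a Kan fibration, paths with one prescribed end can be lifted relatively to a
subcomplex. -/
lemma exists_path_lift (q : E ⟶ Z) [Fibration q] (v : Fin 2) (A : X.Subcomplex)
    (a : Δ[1] ⊗ (A : SSet.{u}) ⟶ E) (z : X ⟶ E) (c : Δ[1] ⊗ X ⟶ Z)
    (haz : cylEnd v _ ≫ a = A.ι ≫ z) (hac : Δ[1] ◁ A.ι ≫ c = a ≫ q)
    (hzc : cylEnd v X ≫ c = z ≫ q) :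
    ∃ l : Δ[1] ⊗ X ⟶ E, Δ[1] ◁ A.ι ≫ l = a ∧ cylEnd v X ≫ l = z ∧ l ≫ q = c := by
  have := SSet.anodyneExtensions_unionProd_ι' (SSet.horn 1 v) A
    (SSet.anodyneExtensions.horn_ι v) q (by rwa [← fibration_iff])
  obtain ⟨l, h1, h2, h3⟩ := exists_path_lift_of_hasLiftingProperty (SSet.horn 1 v) {v}
    (fun n α h l ↦ (val_of_mem_horn v α h l).trans (val_of_mem_horn v α h 0).symm)
    (fun n α h ↦ val_of_mem_horn v α h 0)
    (by
      intro w hw h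
      rw [Set.mem_singleton_iff.1 hw] at h
      have : (if v = 0 then 1 else 0 : Fin 2) ∈ Set.univ := trivial
      rw [← h] at this
      obtain ⟨l, hl⟩ | hl := this
      · replace hl : v = _ := hl
        grind
      · replace hl : _ = v := hl
        grind) A q a (fun _ ↦ z) c
    (fun w hw ↦ by rw [Set.mem_singleton_iff.1 hw]; exact haz) hac
    (fun w hw ↦ by rw [Set.mem_singleton_iff.1 hw]; exact hzc)
  exact ⟨l, h1, h2 v rfl, h3⟩

end Paths

/-! ### Weak equivalences -/

section WeakEquivalences

variable {X Y Z E : SSet.{u}}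

lemma nonempty_homotopy (h : Δ[1] ⊗ X ⟶ Y) :
    Nonempty (SSet.Homotopy (cylEnd 0 X ≫ h) (cylEnd 1 X ≫ h)) :=
  ⟨{ h := (β_ _ _).hom ≫ h
     h₀ := rfl
     h₁ := rfl
     rel := by
      ext n ⟨⟨x, hx⟩, y⟩
      exact hx.elim }⟩

lemma HomotopyClasses.precomp_mk (f : X ⟶ Y) (g : Y ⟶ Z) :
    HomotopyClasses.precomp f Z (Quot.mk _ g) = Quot.mk _ (f ≫ g) := rfl

lemma HomotopyClasses.precomp_comp (f : X ⟶ Y) (g : Y ⟶ Z) (E : SSet.{u}) :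
    HomotopyClasses.precomp (f ≫ g) E =
      HomotopyClasses.precomp f E ∘ HomotopyClasses.precomp g E := by
  funext a
  obtain ⟨a, rfl⟩ := Quot.exists_rep a
  rfl

lemma HomotopyClasses.precomp_id (E : SSet.{u}) : HomotopyClasses.precomp (𝟙 X) E = id := by
  funext a
  obtain ⟨a, rfl⟩ := Quot.exists_rep a
  rfl

lemma HomotopyClasses.precomp_cylEnd (h : Δ[1] ⊗ X ⟶ Y) (E : SSet.{u}) :
    HomotopyClasses.precomp (cylEnd 0 X ≫ h) E = HomotopyClasses.precomp (cylEnd 1 X ≫ h) E := by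
  funext a
  obtain ⟨a, rfl⟩ := Quot.exists_rep a
  exact Quot.sound (nonempty_homotopy (h ≫ a))

/-- Postcomposition `[E, X] → [E, Y]` with a map `f : X ⟶ Y`. -/
def HomotopyClasses.postcomp (f : X ⟶ Y) (E : SSet.{u}) :
    HomotopyClasses E X → HomotopyClasses E Y :=
  Quot.map (fun h ↦ h ≫ f) (by
    rintro a b ⟨H⟩
    have := nonempty_homotopy ((β_ _ _).hom ≫ H.h ≫ f)
    have e0 : cylEnd 0 _ ≫ (β_ _ _).hom ≫ H.h ≫ f = a ≫ f := congrArg (· ≫ f) H.h₀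
    have e1 : cylEnd 1 _ ≫ (β_ _ _).hom ≫ H.h ≫ f = b ≫ f := congrArg (· ≫ f) H.h₁
    rwa [e0, e1] at this)

lemma HomotopyClasses.postcomp_mk (f : X ⟶ Y) (g : E ⟶ X) :
    HomotopyClasses.postcomp f E (Quot.mk _ g) = Quot.mk _ (g ≫ f) := rfl

lemma IsWeakEquiv.id (X : SSet.{u}) : IsWeakEquiv (𝟙 X) := fun E _ ↦ by
  rw [HomotopyClasses.precomp_id]
  exact Function.bijective_id

lemma IsWeakEquiv.comp {f : X ⟶ Y} {g : Y ⟶ Z} (hf : IsWeakEquiv f) (hg : IsWeakEquiv g) :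
    IsWeakEquiv (f ≫ g) := fun E _ ↦ by
  rw [HomotopyClasses.precomp_comp]
  exact (hf E).comp (hg E)

lemma IsWeakEquiv.of_comp_right {f : X ⟶ Y} {g : Y ⟶ Z} (hg : IsWeakEquiv g)
    (hfg : IsWeakEquiv (f ≫ g)) : IsWeakEquiv f := fun E _ ↦ by
  have := hfg E
  rw [HomotopyClasses.precomp_comp] at this
  exact (Function.Bijective.of_comp_iff _ (hg E)).1 this

lemma IsWeakEquiv.of_comp_left {f : X ⟶ Y} {g : Y ⟶ Z} (hf : IsWeakEquiv f)
    (hfg : IsWeakEquiv (f ≫ g)) : IsWeakEquiv g := fun E _ ↦ by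
  have := hfg E
  rw [HomotopyClasses.precomp_comp] at this
  exact (Function.Bijective.of_comp_iff' (hf E) _).1 this

/-- The two-out-of-six property. -/
lemma IsWeakEquiv.two_of_six {f : X ⟶ Y} {g : Y ⟶ Z} {h : Z ⟶ E} (hfg : IsWeakEquiv (f ≫ g))
    (hgh : IsWeakEquiv (g ≫ h)) : IsWeakEquiv f := by
  refine of_comp_right (g := g) (fun K _ ↦ ?_) hfg
  have h1 := hfg K
  have h2 := hgh K
  rw [HomotopyClasses.precomp_comp] at h1 h2
  exact ⟨h1.1.of_comp, h2.2.of_comp⟩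

/-- A map with a section that is also a homotopy inverse is a weak equivalence, and so is the
section. The homotopy may have either direction. -/
lemma isWeakEquiv_of_section {f : X ⟶ Y} {s : Y ⟶ X} (hs : s ≫ f = 𝟙 Y) (h : Δ[1] ⊗ X ⟶ X)
    {v w : Fin 2} (hv : cylEnd v X ≫ h = f ≫ s) (hw : cylEnd w X ≫ h = 𝟙 X) :
    IsWeakEquiv f ∧ IsWeakEquiv s := by
  have key (K : SSet.{u}) : HomotopyClasses.precomp (f ≫ s) K = id := by
    rw [← HomotopyClasses.precomp_id (X := X), ← hv, ← hw]
    fin_cases v <;> fin_cases w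
    exacts [rfl, HomotopyClasses.precomp_cylEnd h K, (HomotopyClasses.precomp_cylEnd h K).symm, rfl]
  have h1 : IsWeakEquiv f := fun K _ ↦ by
    have h1 := key K
    have h2 := congrArg (fun a ↦ HomotopyClasses.precomp a K) hs
    simp only [HomotopyClasses.precomp_comp, HomotopyClasses.precomp_id] at h1 h2
    exact Function.bijective_iff_has_inverse.2 ⟨_, congr_fun h2, congr_fun h1⟩
  refine ⟨h1, h1.of_comp_right ?_⟩
  rw [hs]
  exact .id Y

lemma isWeakEquiv_of_isIso (f : X ⟶ Y) [IsIso f] : IsWeakEquiv f :=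
  IsWeakEquiv.two_of_six (g := inv f) (h := f) (by simpa using .id X) (by simpa using .id Y)

/-- The map out of an empty cylinder. -/
def cylBot (X Y : SSet.{u}) : Δ[1] ⊗ ((⊥ : X.Subcomplex) : SSet.{u}) ⟶ Y where
  app n := ↾fun p ↦ p.2.2.elim
  naturality n m φ := by
    ext p
    exact p.2.2.elim

lemma TrivFib.exists_section {f : X ⟶ Y} (hf : TrivFib f) :
    ∃ s : Y ⟶ X, s ≫ f = 𝟙 Y := by
  have := hf (SSet.Subcomplex.ι (⊥ : Y.Subcomplex))
    (by rw [MorphismProperty.monomorphisms.iff]; infer_instance)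
  have sq : CommSq (SSet.Subcomplex.isInitialBot.to X) (SSet.Subcomplex.ι (⊥ : Y.Subcomplex)) f
    (𝟙 Y) := ⟨SSet.Subcomplex.isInitialBot.hom_ext _ _⟩
  exact ⟨sq.lift, sq.fac_right⟩

lemma TrivFib.isWeakEquiv {f : X ⟶ Y} (hf : TrivFib f) : IsWeakEquiv f := by
  obtain ⟨s, hs⟩ := hf.exists_section
  obtain ⟨l, -, hl, -⟩ := hf.exists_path_lift (⊥ : X.Subcomplex) (cylBot X X) ![f ≫ s, 𝟙 X]
    (snd _ _ ≫ f) (fun v ↦ SSet.Subcomplex.isInitialBot.hom_ext _ _) (by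
      ext n p
      exact p.2.2.elim) (by
      intro v
      fin_cases v
      · change f = (f ≫ s) ≫ f
        rw [Category.assoc, hs, Category.comp_id]
      · rfl)
  exact (isWeakEquiv_of_section hs l (hl 0) (hl 1)).1

/-- To show that a map is a trivial fibration, it suffices to lift against inclusions of
subcomplexes. -/
lemma trivFib_of_subcomplex (p : X ⟶ Y)
    (H : ∀ (B : SSet.{u}) (A : B.Subcomplex) (f : (A : SSet.{u}) ⟶ X) (g : B ⟶ Y),
      f ≫ p = A.ι ≫ g → ∃ l, A.ι ≫ l = f ∧ l ≫ p = g) : TrivFib p := by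
  change (MorphismProperty.monomorphisms SSet.{u}).rlp p
  rw [SSet.rlp_monomorphisms]
  rintro _ _ _ ⟨n⟩
  refine ⟨fun {f g} sq ↦ ?_⟩
  obtain ⟨l, h1, h2⟩ := H _ _ f g sq.w
  exact ⟨⟨l, h1, h2⟩⟩

end WeakEquivalences

/-! ### Loop spaces of Kan complexes -/

section Loops

variable {X Y Z E : SSet.{u}}

lemma cylEnd_uncurry (g : X ⟶ (ihom Δ[1]).obj Y) (v : Fin 2) :
    cylEnd v X ≫ MonoidalClosed.uncurry g = g ≫ evalAt Y v := by
  rw [← curry_evalAt, MonoidalClosed.curry_uncurry]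

lemma range_le_fiber_iff {p : X ⟶ Y} {y : Y _⦋0⦌} {f : E ⟶ X} :
    Subfunctor.range f ≤ fiber p y ↔ f ≫ p = SSet.const y := by
  constructor
  · intro h
    ext n x
    exact (mem_fiber_iff p y _).1 (h n ⟨x, rfl⟩)
  · rintro h n _ ⟨x, rfl⟩
    rw [mem_fiber_iff]
    exact ConcreteCategory.congr_hom (congr_app h n) x

lemma ι_comp_of_le_fiber {p : X ⟶ Y} {y : Y _⦋0⦌} {A : X.Subcomplex} (h : A ≤ fiber p y) :
    A.ι ≫ p = SSet.const y := by
  rw [← range_le_fiber_iff, Subfunctor.range_ι]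
  exact h

lemma loopSpace_ι_evalAt (y : Y _⦋0⦌) (v : Fin 2) :
    (loopSpace Y y).ι ≫ evalAt Y v = SSet.const y := by
  fin_cases v
  exacts [ι_comp_of_le_fiber inf_le_left, ι_comp_of_le_fiber inf_le_right]

/-- The map to a loop space given by a family of loops. -/
def loopLift (y : Y _⦋0⦌) (h : Δ[1] ⊗ X ⟶ Y) (hv : ∀ v, cylEnd v X ≫ h = SSet.const y) :
    X ⟶ (loopSpace Y y : SSet.{u}) :=
  SSet.Subcomplex.lift (MonoidalClosed.curry h) (le_inf
    (range_le_fiber_iff.2 ((curry_evalAt h 0).trans (hv 0)))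
    (range_le_fiber_iff.2 ((curry_evalAt h 1).trans (hv 1))))

lemma loopLift_ι (y : Y _⦋0⦌) (h : Δ[1] ⊗ X ⟶ Y) (hv : ∀ v, cylEnd v X ≫ h = SSet.const y) :
    loopLift y h hv ≫ (loopSpace Y y).ι = MonoidalClosed.curry h := rfl

lemma loopSpaceMap_ι (f : X ⟶ Y) (x : X _⦋0⦌) (y : Y _⦋0⦌) (h : f.app _ x = y) :
    loopSpaceMap f x y h ≫ (loopSpace Y y).ι = (loopSpace X x).ι ≫ (ihom Δ[1]).map f := rfl

lemma loopSpaceMap_comp (f : X ⟶ Y) (g : Y ⟶ Z) (x : X _⦋0⦌) (y : Y _⦋0⦌) (z : Z _⦋0⦌)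
    (h : f.app _ x = y) (h' : g.app _ y = z) :
    loopSpaceMap f x y h ≫ loopSpaceMap g y z h' = loopSpaceMap (f ≫ g) x z (by
      rw [← h', ← h]; rfl) := by
  rw [← cancel_mono (loopSpace Z z).ι, Category.assoc, loopSpaceMap_ι, loopSpaceMap_ι,
    ← Category.assoc, loopSpaceMap_ι, Functor.map_comp, Category.assoc]

lemma loopSpaceMap_id (x : X _⦋0⦌) : loopSpaceMap (𝟙 X) x x rfl = 𝟙 _ := by
  rw [← cancel_mono (loopSpace X x).ι]
  refine (loopSpaceMap_ι _ _ _ _).trans ?_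
  rw [CategoryTheory.Functor.map_id, Category.comp_id, Category.id_comp]

lemma TrivFib.loopSpaceMap {q : E ⟶ Z} (hq : TrivFib q) (e : E _⦋0⦌) (z : Z _⦋0⦌)
    (h : q.app _ e = z) : TrivFib (loopSpaceMap q e z h) := by
  refine trivFib_of_subcomplex _ fun B A f g w ↦ ?_
  obtain ⟨l, h1, h2, h3⟩ := hq.exists_path_lift A (MonoidalClosed.uncurry (f ≫ Subfunctor.ι _))
    (fun _ ↦ SSet.const e) (MonoidalClosed.uncurry (g ≫ Subfunctor.ι _)) (fun v ↦ by
      rw [cylEnd_uncurry, Category.assoc, loopSpace_ι_evalAt]; rfl) (by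
      rw [← MonoidalClosed.uncurry_natural_left, ← MonoidalClosed.uncurry_natural_right,
        ← Category.assoc, ← w, Category.assoc, Category.assoc, loopSpaceMap_ι]) (fun v ↦ by
      rw [cylEnd_uncurry, Category.assoc, loopSpace_ι_evalAt, SSet.const_comp, h]; rfl)
  refine ⟨loopLift e l h2, ?_, ?_⟩
  · rw [← cancel_mono (Subfunctor.ι _), Category.assoc, loopLift_ι,
      ← MonoidalClosed.curry_natural_left, h1, MonoidalClosed.curry_uncurry]
  · rw [← cancel_mono (Subfunctor.ι _), Category.assoc, loopSpaceMap_ι, ← Category.assoc,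
      loopLift_ι, ← MonoidalClosed.curry_natural_right, h3, MonoidalClosed.curry_uncurry]

lemma trivFib_evalAt (Z : SSet.{u}) [SSet.KanComplex Z] (v : Fin 2) : TrivFib (evalAt Z v) := by
  refine trivFib_of_subcomplex _ fun B A f g w ↦ ?_
  have : Fibration (Limits.terminal.from Z) := (isFibrant_iff _).1 inferInstance
  obtain ⟨l, h1, h2, h3⟩ := exists_path_lift (Limits.terminal.from Z) v A
    (MonoidalClosed.uncurry f) g (Limits.terminal.from _) (by rw [cylEnd_uncurry, w])
    (Subsingleton.elim _ _) (Subsingleton.elim _ _)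
  refine ⟨MonoidalClosed.curry l, ?_, ?_⟩
  · rw [← MonoidalClosed.curry_natural_left, h1, MonoidalClosed.curry_uncurry]
  · rw [curry_evalAt, h2]

/-- The maps of loop spaces induced by `f` are weak equivalences, for all choices of the base
point. -/
def IsLoopEquiv (f : X ⟶ Y) : Prop := ∀ x y h, IsWeakEquiv (loopSpaceMap f x y h)

lemma IsLoopEquiv.id (X : SSet.{u}) : IsLoopEquiv (𝟙 X) := by
  rintro x _ rfl
  exact (loopSpaceMap_id x) ▸ IsWeakEquiv.id _

/-- A homotopy `h` from `f` to `g` is a map to `Z^{Δ[1]}`, and the evaluations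
`Z^{Δ[1]} ⟶ Z` are trivial fibrations. -/
lemma isLoopEquiv_iff_of_homotopy [SSet.KanComplex Z] (h : X ⟶ (ihom Δ[1]).obj Z) (v : Fin 2) :
    IsLoopEquiv (h ≫ evalAt Z v) ↔ IsLoopEquiv h := by
  constructor
  · rintro H x _ rfl
    refine IsWeakEquiv.of_comp_right
      ((trivFib_evalAt Z v).loopSpaceMap (h.app _ x) _ rfl).isWeakEquiv ?_
    rw [loopSpaceMap_comp]
    exact H _ _ _
  · rintro H x _ rfl
    have := (H x _ rfl).comp ((trivFib_evalAt Z v).loopSpaceMap (h.app _ x) _ rfl).isWeakEquiv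
    rw [loopSpaceMap_comp] at this
    exact this

lemma isLoopEquiv_congr [SSet.KanComplex Z] {f g : X ⟶ Z}
    (h : (Quot.mk _ f : HomotopyClasses X Z) = Quot.mk _ g) :
    IsLoopEquiv f ↔ IsLoopEquiv g := by
  have := Quot.eqvGen_exact h
  induction this with
  | refl => rfl
  | symm _ _ _ ih => exact (ih (Quot.eqvGen_sound (by assumption))).symm
  | trans _ _ _ h1 h2 ih1 ih2 =>
    exact (ih1 (Quot.eqvGen_sound h1)).trans (ih2 (Quot.eqvGen_sound h2))
  | rel f g H =>
    obtain ⟨H⟩ := H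
    have h0 : MonoidalClosed.curry ((β_ _ _).hom ≫ H.h) ≫ evalAt Z 0 = f := by
      rw [curry_evalAt]
      exact H.h₀
    have h1 : MonoidalClosed.curry ((β_ _ _).hom ≫ H.h) ≫ evalAt Z 1 = g := by
      rw [curry_evalAt]
      exact H.h₁
    have h2 := isLoopEquiv_iff_of_homotopy (MonoidalClosed.curry ((β_ _ _).hom ≫ H.h)) 0
    have h3 := isLoopEquiv_iff_of_homotopy (MonoidalClosed.curry ((β_ _ _).hom ≫ H.h)) 1
    rw [h0] at h2
    rw [h1] at h3
    exact h2.trans h3.symm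

/-- A weak equivalence between Kan complexes is a homotopy equivalence, and so is the induced map
of loop spaces. -/
theorem IsWeakEquiv.isLoopEquiv [SSet.KanComplex X] [SSet.KanComplex Y] {f : X ⟶ Y}
    (hf : IsWeakEquiv f) : IsLoopEquiv f := by
  obtain ⟨k, hk⟩ := (hf X).2 (Quot.mk _ (𝟙 X))
  obtain ⟨k, rfl⟩ := Quot.exists_rep k
  have h1 : IsLoopEquiv (f ≫ k) := (isLoopEquiv_congr hk).2 (.id X)
  have h2 : IsLoopEquiv (k ≫ f) := by
    refine (isLoopEquiv_congr ((hf Y).1 ?_)).2 (.id Y)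
    rw [HomotopyClasses.precomp_mk, HomotopyClasses.precomp_mk, Category.comp_id]
    have := congrArg (HomotopyClasses.postcomp f X) hk
    rw [HomotopyClasses.precomp_mk, HomotopyClasses.postcomp_mk, HomotopyClasses.postcomp_mk,
      Category.id_comp, Category.assoc] at this
    exact this
  rintro x _ rfl
  refine IsWeakEquiv.two_of_six (g := loopSpaceMap k _ _ rfl) (h := loopSpaceMap f _ _ rfl) ?_ ?_
  · rw [loopSpaceMap_comp]
    exact h1 _ _ _
  · rw [loopSpaceMap_comp]
    exact h2 _ _ _

end Loops

/-- The degenerate `n`-simplex at a vertex. -/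
abbrev degen {Y : SSet.{u}} (y : Y _⦋0⦌) (n : SimplexCategoryᵒᵖ) : Y.obj n :=
  Y.map (n.unop.const ⦋0⦌ 0).op y

lemma map_degen {Y : SSet.{u}} (y : Y _⦋0⦌) {n m : SimplexCategoryᵒᵖ} (φ : n ⟶ m) :
    Y.map φ (degen y n) = degen y m := (map_comp_apply Y φ.unop _ y).symm

lemma degen_zero {Y : SSet.{u}} (y : Y _⦋0⦌) : degen y (op ⦋0⦌) = y :=
  (congrArg (fun φ : ⦋0⦌ ⟶ ⦋0⦌ ↦ Y.map φ.op y) (Subsingleton.elim _ (𝟙 ⦋0⦌))).trans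
    (Functor.map_id_apply Y _ y)

lemma app_degen {X Y : SSet.{u}} (f : X ⟶ Y) (x : X _⦋0⦌) (n : SimplexCategoryᵒᵖ) :
    f.app n (degen x n) = degen (f.app _ x) n := NatTrans.naturality_apply f _ x

namespace SimplicialGroupoid

variable {G : SimplicialGroupoid.{u}}

/-! ### The path fibration of the classifying space -/

section Star

variable (c : G.ob _⦋0⦌)

variable (G) in
/-- The simplicial set of arrows with source `c`. -/
abbrev under : SSet.{u} := (fiber G.s c : SSet.{u})

variable (G) in
/-- The map that sends an arrow with source `c` to its target. -/
abbrev under.t : G.under c ⟶ G.ob := (fiber G.s c).ι ≫ G.t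

variable {c}

lemma under.s_val {n : SimplexCategoryᵒᵖ} (x : (G.under c).obj n) :
    G.s.app n x.1 = degen c n := (mem_fiber_iff _ _ _).1 x.2

/-- An arrow with source `c`, as a simplex of `G.under c`. -/
abbrev under.mk {n : SimplexCategoryᵒᵖ} (f : G.ar.obj n) (hf : G.s.app n f = degen c n) :
    (G.under c).obj n := ⟨f, (mem_fiber_iff _ _ _).2 hf⟩

instance [Fibration (CartesianMonoidalCategory.lift G.s G.t)] : Fibration (under.t G c) := by
  refine fibration_of_filler _ fun n i y b hy hb ↦ ?_
  obtain ⟨x, hx, hx'⟩ := exists_filler (CartesianMonoidalCategory.lift G.s G.t) i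
    (fun j hj ↦ (y j hj).1) (degen c _, b)
    (fun m φ ψ j k hj hk _ _ h ↦ hy.map (fiber G.s c).ι m φ ψ j k hj hk h)
    (fun j hj ↦ Prod.ext ((under.s_val _).trans (map_degen c _).symm) (hb j hj))
  exact ⟨under.mk x (congrArg Prod.fst hx'), fun j hj ↦ Subtype.ext (hx j hj),
    congrArg Prod.snd hx'⟩

/-- A tuple of arrows with source `c` is a star. -/
def tupUnderToStars : tup (G.under c) ⟶ G.stars where
  app n := ↾fun x ↦ { arr l := (x l).1, s_eq i j := by rw [under.s_val, under.s_val] }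

variable (G c) in
/-- The map that sends a tuple `x` of arrows with source `c` to the matrix with entries
`(x i)⁻¹ ≫ x j`. -/
def pathFib : tup (G.under c) ⟶ G.W := tupUnderToStars ≫ G.starMatrix

lemma pathFib_apply {n : SimplexCategoryᵒᵖ} (x : (tup (G.under c)).obj n) (i j) :
    ((pathFib G c).app n x).arr i j = G.mul (G.i.app n (x i).1) (x j).1 := rfl

instance [Fibration (CartesianMonoidalCategory.lift G.s G.t)] : Fibration (pathFib G c) := by
  refine fibration_of_filler _ fun n i y b hy hb ↦ ?_
  obtain ⟨x, hx, hx'⟩ := exists_vertex_filler (under.t G c) i y hy (W.ob.app _ b i) (by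
    rintro j hj q rfl
    have h := congrArg (fun f : G.Mat _ ↦ W.ob.app _ f q) (hb j hj)
    have h' : W.ob.app _ ((pathFib G c).app _ (y j hj)) q = G.t.app _ (y j hj q).1 := by
      rw [← Mat.t_apply _ q q, pathFib_apply, t_mul]
      rw [t_i, under.s_val]
    exact h'.symm.trans (h.trans (s_map _ _)))
  have hx0 : G.t.app _ x.1 = W.ob.app _ b i := hx
  have h1 (l) : G.t.app _ x.1 = G.s.app _ (b.arr i l) := hx0.trans (b.s_apply i l).symm
  -- `x` is the entry of the filler at the vertex `i`, and the others are determined by it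
  refine ⟨fun l ↦ under.mk (G.mul x.1 (b.arr i l)) ((s_mul (h1 l)).trans (under.s_val x)),
    fun j hj ↦ funext fun l ↦ Subtype.ext ?_, ?_⟩
  · obtain ⟨q, rfl⟩ := Fin.exists_succAbove_eq hj.symm
    have h2 : G.ar.map (SimplexCategory.δ j).op x.1 = (y j hj q).1 :=
      congrArg Subtype.val (hx' j hj q rfl)
    have h3 : G.mul (G.i.app _ (y j hj q).1) (y j hj l).1 =
        G.ar.map (SimplexCategory.δ j).op (b.arr (j.succAbove q) (j.succAbove l)) :=
      congrArg (fun f : G.Mat (op ⦋n⦌) ↦ f.arr q l) (hb j hj)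
    refine (map_mul _ (h1 _)).trans ?_
    refine (congrArg₂ G.mul h2 h3.symm).trans ?_
    rw [mul_i_mul]
    rw [under.s_val, under.s_val]
  · refine Mat.ext_row i fun l ↦ ?_
    rw [pathFib_apply]
    change G.mul (G.i.app _ (G.mul x.1 (b.arr i i))) (G.mul x.1 (b.arr i l)) = _
    rw [b.diag_apply, mul_e hx0, i_mul_mul (h1 l)]

variable (G c) in
/-- The vertex of `W G` given by `c`. -/
abbrev vertexW : G.W _⦋0⦌ := G.toW.app _ (G.vertex c)

lemma degen_vertexW (n : SimplexCategoryᵒᵖ) (i j) :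
    (degen (vertexW G c) n : G.Mat n).arr i j = G.e.app n (degen c n) := by
  rw [app_degen]
  exact congrArg (G.ar.map (n.unop.const ⦋0⦌ 0).op)
    (G.toW_apply (n := op ⦋0⦌) (G.vertex c) (i := 0) (j := 0) le_rfl)

/-- The fibre of `pathFib G c` over `c` consists of the constant tuples of arrows from `c` to
`c`. -/
lemma pathFib_eq_degen_iff {n : SimplexCategoryᵒᵖ} (x : (tup (G.under c)).obj n) :
    (pathFib G c).app n x = degen (vertexW G c) n ↔
      G.t.app n (x 0).1 = degen c n ∧ ∀ l, x l = x 0 := by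
  have hs (i j) : G.t.app n (G.i.app n (x i).1) = G.s.app n (x j).1 := by
    rw [t_i, under.s_val, under.s_val]
  constructor
  · intro h
    have h1 (i j) : G.mul (G.i.app n (x i).1) (x j).1 = G.e.app n (degen c n) := by
      rw [← pathFib_apply, h, degen_vertexW]
    have h2 (j) : G.t.app n (x j).1 = degen c n := by
      rw [← t_mul (hs 0 j), h1, G.t_e]
    refine ⟨h2 0, fun l ↦ Subtype.ext ?_⟩
    refine mul_left_cancel (hs 0 l) (hs 0 0) ?_
    rw [h1, h1]
  · rintro ⟨h1, h2⟩
    refine Mat.ext' fun i j ↦ ?_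
    rw [degen_vertexW, pathFib_apply, h2 i, h2 j, i_mul, h1]

end Star


/-! ### The loop space of the classifying space -/

section Loops

variable {c : G.ob _⦋0⦌} {X : SSet.{u}}

variable (G c) in
/-- The constant tuple of identities of `c`. -/
def idTup : (tup (G.under c)) _⦋0⦌ :=
  fun _ ↦ under.mk (G.e.app _ c) ((G.s_e _).trans (degen_zero c).symm)

lemma degen_idTup (n : SimplexCategoryᵒᵖ) (l) :
    (degen (idTup G c) n l).1 = G.e.app n (degen c n) :=
  map_e (n.unop.const ⦋0⦌ 0).op c

lemma pathFib_idTup : (pathFib G c).app _ (idTup G c) = vertexW G c := by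
  have := (pathFib_eq_degen_iff (G := G) (c := c) (degen (idTup G c) (op ⦋0⦌))).2
    ⟨by rw [degen_idTup, G.t_e], fun l ↦ rfl⟩
  rwa [degen_zero, degen_zero] at this

lemma s_endo {n : SimplexCategoryᵒᵖ} (f : (G.endo c : SSet.{u}).obj n) :
    G.s.app n f.1 = degen c n := (mem_fiber_iff _ _ _).1 f.2.1

lemma t_endo {n : SimplexCategoryᵒᵖ} (f : (G.endo c : SSet.{u}).obj n) :
    G.t.app n f.1 = degen c n := (mem_fiber_iff _ _ _).1 f.2.2

variable (G c) in
/-- The constant tuples of arrows from `c` to `c`. They form the fibre of `pathFib G c`. -/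
def endoTup : (G.endo c : SSet.{u}) ⟶ tup (G.under c) where
  app n := ↾fun f _ ↦ under.mk f.1 (s_endo f)

lemma endoTup_pathFib : endoTup G c ≫ pathFib G c = SSet.const (vertexW G c) := by
  ext n f
  exact (pathFib_eq_degen_iff _).2 ⟨t_endo f, fun _ ↦ rfl⟩

/-- A map to the fibre of `pathFib G c` is a map to `G(c, c)`. -/
def toEndo (f : X ⟶ tup (G.under c)) (hf : f ≫ pathFib G c = SSet.const (vertexW G c)) :
    X ⟶ (G.endo c : SSet.{u}) where
  app n := ↾fun x ↦ ⟨(f.app n x 0).1, (f.app n x 0).2, (mem_fiber_iff _ _ _).2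
    ((pathFib_eq_degen_iff _).1 (ConcreteCategory.congr_hom (congr_app hf n) x)).1⟩
  naturality n m φ := by
    ext x
    refine Subtype.ext ?_
    have h1 : f.app m (X.map φ x) 0 =
        (G.under c).map φ (f.app n x (φ.unop.toOrderHom 0)) :=
      congr_fun (NatTrans.naturality_apply f φ x) 0
    have h2 := ((pathFib_eq_degen_iff _).1 (ConcreteCategory.congr_hom (congr_app hf n) x)).2
      (φ.unop.toOrderHom 0)
    refine (congrArg Subtype.val h1).trans ?_
    exact congrArg (fun y : (G.under c).obj n ↦ G.ar.map φ y.1) h2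

lemma toEndo_endoTup (f : X ⟶ tup (G.under c))
    (hf : f ≫ pathFib G c = SSet.const (vertexW G c)) : toEndo f hf ≫ endoTup G c = f := by
  ext n x l
  exact (((pathFib_eq_degen_iff _).1 (ConcreteCategory.congr_hom (congr_app hf n) x)).2 l).symm

instance : Mono (endoTup G c) := ⟨fun g h w ↦ by
  ext n x
  refine Subtype.ext ?_
  have := congr_fun (ConcreteCategory.congr_hom (congr_app w n) x) 0
  exact congrArg (fun y : (G.under c).obj n ↦ y.1) this⟩

variable (G c) in
/-- The paths in `tup (G.under c)` from the identity of `c` to the fibre of `pathFib G c`. -/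
def fibPaths : ((ihom Δ[1]).obj (tup (G.under c))).Subcomplex :=
  fiber (evalAt _ 0) (idTup G c) ⊓ fiber (evalAt _ 1 ≫ pathFib G c) (vertexW G c)

lemma fibPaths_ι_zero : (fibPaths G c).ι ≫ evalAt _ 0 = SSet.const (idTup G c) :=
  ι_comp_of_le_fiber inf_le_left

lemma fibPaths_ι_one :
    ((fibPaths G c).ι ≫ evalAt _ 1) ≫ pathFib G c = SSet.const (vertexW G c) :=
  (Category.assoc _ _ _).trans (ι_comp_of_le_fiber inf_le_right)

/-- The map to `fibPaths G c` given by a family of paths. -/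
def fibPathsLift (h : Δ[1] ⊗ X ⟶ tup (G.under c)) (h0 : cylEnd 0 X ≫ h = SSet.const (idTup G c))
    (h1 : (cylEnd 1 X ≫ h) ≫ pathFib G c = SSet.const (vertexW G c)) :
    X ⟶ (fibPaths G c : SSet.{u}) :=
  SSet.Subcomplex.lift (MonoidalClosed.curry h) (le_inf
    (range_le_fiber_iff.2 ((curry_evalAt h 0).trans h0))
    (range_le_fiber_iff.2 (by rw [← Category.assoc, curry_evalAt]; exact h1)))

lemma fibPathsLift_ι (h : Δ[1] ⊗ X ⟶ tup (G.under c)) (h0) (h1) :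
    fibPathsLift h h0 h1 ≫ (fibPaths G c).ι = MonoidalClosed.curry h := rfl

variable (G c) in
/-- The image in `W G` of a path in `fibPaths G c` is a loop. -/
def fibPathsToLoop : (fibPaths G c : SSet.{u}) ⟶ (loopSpace G.W (vertexW G c) : SSet.{u}) :=
  SSet.Subcomplex.lift ((fibPaths G c).ι ≫ (ihom Δ[1]).map (pathFib G c)) (le_inf
    (range_le_fiber_iff.2 (by
      rw [Category.assoc, evalAt_naturality, ← Category.assoc, fibPaths_ι_zero, SSet.const_comp,
        pathFib_idTup]))
    (range_le_fiber_iff.2 (by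
      rw [Category.assoc, evalAt_naturality, ← Category.assoc, fibPaths_ι_one])))

lemma fibPathsToLoop_ι : fibPathsToLoop G c ≫ (loopSpace G.W (vertexW G c)).ι =
    (fibPaths G c).ι ≫ (ihom Δ[1]).map (pathFib G c) := rfl

variable (G c) in
/-- The end of a path in `fibPaths G c`. -/
def fibPathsEnd : (fibPaths G c : SSet.{u}) ⟶ (G.endo c : SSet.{u}) :=
  toEndo ((fibPaths G c).ι ≫ evalAt _ 1) fibPaths_ι_one

/-- A loop in `W G` lifts to a path that starts at the identity of `c`. -/
lemma trivFib_fibPathsToLoop [Fibration (CartesianMonoidalCategory.lift G.s G.t)] :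
    TrivFib (fibPathsToLoop G c) := by
  refine trivFib_of_subcomplex _ fun B A f g w ↦ ?_
  have hw : MonoidalClosed.uncurry (f ≫ (fibPaths G c).ι) ≫ pathFib G c =
      Δ[1] ◁ A.ι ≫ MonoidalClosed.uncurry (g ≫ Subfunctor.ι _) := by
    rw [← MonoidalClosed.uncurry_natural_left, ← MonoidalClosed.uncurry_natural_right,
      ← Category.assoc A.ι, ← w, Category.assoc, Category.assoc, fibPathsToLoop_ι]
  obtain ⟨l, h1, h2, h3⟩ := exists_path_lift (pathFib G c) 0 A
    (MonoidalClosed.uncurry (f ≫ Subfunctor.ι _)) (SSet.const (idTup G c))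
    (MonoidalClosed.uncurry (g ≫ Subfunctor.ι _)) (by
      rw [cylEnd_uncurry, Category.assoc, fibPaths_ι_zero]; rfl) hw.symm (by
      rw [cylEnd_uncurry, Category.assoc, loopSpace_ι_evalAt, SSet.const_comp, pathFib_idTup]; rfl)
  refine ⟨fibPathsLift l h2 ?_, ?_, ?_⟩
  · rw [Category.assoc, h3, cylEnd_uncurry, Category.assoc, loopSpace_ι_evalAt]; rfl
  · rw [← cancel_mono (Subfunctor.ι _), Category.assoc, fibPathsLift_ι,
      ← MonoidalClosed.curry_natural_left, h1, MonoidalClosed.curry_uncurry]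
  · rw [← cancel_mono (Subfunctor.ι _), Category.assoc, fibPathsToLoop_ι, ← Category.assoc,
      fibPathsLift_ι, ← MonoidalClosed.curry_natural_right, h3, MonoidalClosed.curry_uncurry]

/-- A path in `tup (G.under c)` can be prescribed at its ends, since `tup (G.under c)` is
contractible. -/
lemma trivFib_fibPathsEnd [SSet.KanComplex G.ob]
    [Fibration (CartesianMonoidalCategory.lift G.s G.t)] : TrivFib (fibPathsEnd G c) := by
  have : SSet.KanComplex (G.under c) := isFibrant_of_fibration (under.t G c)
  have : Fibration (Limits.terminal.from (G.under c)) := (isFibrant_iff _).1 inferInstance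
  have hT := trivFib_tupMap (Limits.terminal.from (G.under c))
    (fun _ ↦ ⟨idTup G c 0, Subsingleton.elim _ _⟩)
  have hs {X : SSet.{u}} (a b : X ⟶ tup (⊤_ SSet.{u})) : a = b := by
    ext n x l
    exact Subsingleton.elim _ _
  refine trivFib_of_subcomplex _ fun B A f g w ↦ ?_
  have hw : (f ≫ (fibPaths G c).ι) ≫ evalAt _ 1 = A.ι ≫ g ≫ endoTup G c := by
    rw [← Category.assoc A.ι, ← w, Category.assoc, Category.assoc, fibPathsEnd, toEndo_endoTup]
  obtain ⟨l, h1, h2, -⟩ := hT.exists_path_lift A (MonoidalClosed.uncurry (f ≫ Subfunctor.ι _))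
    ![SSet.const (idTup G c), g ≫ endoTup G c] 
    (SSet.const ((tupMap (Limits.terminal.from (G.under c))).app _ (idTup G c))) (fun v ↦ by
      rw [cylEnd_uncurry]
      fin_cases v
      · exact (Category.assoc _ _ _).trans (congrArg (f ≫ ·) fibPaths_ι_zero)
      · exact hw) (hs _ _) (fun _ ↦ hs _ _)
  have h20 : cylEnd 0 B ≫ l = SSet.const (idTup G c) := h2 0
  have h21 : cylEnd 1 B ≫ l = g ≫ endoTup G c := h2 1
  refine ⟨fibPathsLift l h20 ?_, ?_, ?_⟩
  · rw [h21, Category.assoc, endoTup_pathFib]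
    rfl
  · rw [← cancel_mono (Subfunctor.ι _), Category.assoc, fibPathsLift_ι,
      ← MonoidalClosed.curry_natural_left, h1, MonoidalClosed.curry_uncurry]
  · rw [← cancel_mono (endoTup G c), Category.assoc, fibPathsEnd, toEndo_endoTup, ← Category.assoc,
      fibPathsLift_ι, curry_evalAt, h21]

variable (G c) in
/-- The canonical path in `tup (G.under c)` that ends at a given arrow from `c` to `c`. -/
def endoPath : Δ[1] ⊗ (G.endo c : SSet.{u}) ⟶ tup (G.under c) where
  app n := ↾fun p l ↦
    if val p.1 l = 0 then under.mk (G.e.app n (degen c n)) (G.s_e _)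
    else under.mk p.2.1 (s_endo p.2)
  naturality n m φ := by
    ext p l
    refine (?_ : _ = (G.under c).map φ (if val p.1 (φ.unop.toOrderHom l) = 0 then
      under.mk (G.e.app n (degen c n)) (G.s_e _) else under.mk p.2.1 (s_endo p.2)))
    rw [apply_ite ((G.under c).map φ)]
    have : (G.under c).map φ (under.mk (G.e.app n (degen c n)) (G.s_e _)) =
        under.mk (G.e.app m (degen c m)) (G.s_e _) :=
      Subtype.ext ((map_e φ _).trans (congrArg (G.e.app m) (map_degen c φ)))
    rw [this]
    rfl

lemma endoPath_zero : cylEnd 0 _ ≫ endoPath G c = SSet.const (idTup G c) := by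
  ext n f l
  exact Subtype.ext (degen_idTup n l).symm

lemma endoPath_one : cylEnd 1 _ ≫ endoPath G c = endoTup G c := by
  ext n f l
  rfl

lemma arrow_map_val {n : SimplexCategoryᵒᵖ} (f : G.ar.obj n) {v w : Fin 2} (h : v ≤ w) :
    ((G.arrow f).map (homOfLE h)).1 =
      if v = w then G.e.app n ((G.arrow f).obj v) else f := by
  obtain rfl | hvw := eq_or_ne v w
  · rw [if_pos rfl]
    exact congrArg Subtype.val ((G.arrow f).map_id v)
  · obtain rfl : v = 0 := by omega
    obtain rfl : w = 1 := by omega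
    rfl

/-- The canonical paths lift the loops that define `G.toLoopSpace c`. -/
lemma endoPath_pathFib :
    endoPath G c ≫ pathFib G c = Δ[1] ◁ (G.endo c).ι ≫ G.arrowPath ≫ G.toW := by
  ext n ⟨α, f⟩
  refine Mat.ext_row (n := n) 0 fun j ↦ ?_
  have h0 : val α 0 ≤ val α j := (SSet.stdSimplex.objEquiv α).toOrderHom.monotone (Fin.zero_le j)
  refine Eq.trans ?_ ((G.toW_apply _ (Fin.zero_le j)).trans (arrow_map_val f.1 h0)).symm
  have hp (l) : ((endoPath G c).app n (α, f) l).1 =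
      if val α l = 0 then G.e.app n (degen c n) else f.1 :=
    apply_ite Subtype.val _ _ _
  have hs : G.s.app n f.1 = degen c n := s_endo f
  refine (congrArg₂ (fun x y ↦ G.mul (G.i.app n x) y) (hp 0) (hp j)).trans ?_
  generalize val α 0 = v at h0 ⊢
  generalize val α j = w at h0 ⊢
  fin_cases v <;> fin_cases w
  · change G.mul (G.i.app n (G.e.app n (degen c n))) (G.e.app n (degen c n)) =
      G.e.app n (G.s.app n f.1)
    rw [i_e, e_mul (G.s_e _).symm, hs]
  · change G.mul (G.i.app n (G.e.app n (degen c n))) f.1 = f.1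
    rw [i_e, e_mul hs.symm]
  · exact absurd h0 (by decide)
  · exact i_mul f.1

/-- If `ob(G)` is a Kan complex, then `G(c, c)` and the loop space of `W G` are both equivalent to
the simplicial set of the paths in `tup (G.under c)` from the identity of `c` to `G(c, c)`. -/
theorem isWeakEquiv_toLoopSpace_of_kanComplex_ob [SSet.KanComplex G.ob]
    [Fibration (CartesianMonoidalCategory.lift G.s G.t)] (c : G.ob _⦋0⦌) :
    IsWeakEquiv (G.toLoopSpace c) := by
  let μ : (G.endo c : SSet.{u}) ⟶ (fibPaths G c : SSet.{u}) :=
    fibPathsLift (endoPath G c) endoPath_zero (by rw [endoPath_one, endoTup_pathFib])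
  have h1 : μ ≫ fibPathsEnd G c = 𝟙 _ := by
    rw [← cancel_mono (endoTup G c), Category.assoc, fibPathsEnd, toEndo_endoTup, ← Category.assoc,
      fibPathsLift_ι, curry_evalAt, endoPath_one, Category.id_comp]
  have h2 : μ ≫ fibPathsToLoop G c =
      G.toLoopSpace c ≫ loopSpaceMap G.toW (G.vertex c) (vertexW G c) rfl := by
    rw [← cancel_mono (Subfunctor.ι _), Category.assoc, fibPathsToLoop_ι, ← Category.assoc,
      fibPathsLift_ι, Category.assoc, loopSpaceMap_ι]
    change _ = ((G.endo c).ι ≫ MonoidalClosed.curry G.arrowPath) ≫ (ihom Δ[1]).map G.toW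
    rw [Category.assoc, ← MonoidalClosed.curry_natural_right, ← MonoidalClosed.curry_natural_right,
      ← MonoidalClosed.curry_natural_left, endoPath_pathFib]
  have h3 : TrivFib G.toW := MorphismProperty.of_isIso (MorphismProperty.rlp _) _
  refine (h3.loopSpaceMap _ _ rfl).isWeakEquiv.of_comp_right ?_
  rw [← h2]
  refine IsWeakEquiv.comp ?_ trivFib_fibPathsToLoop.isWeakEquiv
  exact trivFib_fibPathsEnd.isWeakEquiv.of_comp_right (h1 ▸ .id _)

end Loops


/-! ### Restriction of a simplicial groupoid to other objects -/

section Restrict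

variable {C : SSet.{u}} (ι : C ⟶ G.ob)

/-- The arrows of the restriction of `G` along a map `ι` to the objects of `G`: the arrows from
`ι x` to `ι y` for simplices `x` and `y` of `C`. -/
@[reducible]
def restrictAr : SSet.{u} where
  obj n := {p : (C.obj n × C.obj n) × G.ar.obj n //
    G.s.app n p.2 = ι.app n p.1.1 ∧ G.t.app n p.2 = ι.app n p.1.2}
  map φ := ↾fun p ↦ ⟨((C.map φ p.1.1.1, C.map φ p.1.1.2), G.ar.map φ p.1.2), by
    rw [s_map, NatTrans.naturality_apply, p.2.1], by rw [t_map, NatTrans.naturality_apply, p.2.2]⟩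
  map_id n := by
    ext p
    · exact Functor.map_id_apply C n _
    · exact Functor.map_id_apply C n _
    · exact Functor.map_id_apply G.ar n _
  map_comp φ ψ := by
    ext p
    · exact Functor.map_comp_apply C φ ψ _
    · exact Functor.map_comp_apply C φ ψ _
    · exact Functor.map_comp_apply G.ar φ ψ _

variable {ι} in
lemma restrictAr_ext {n : SimplexCategoryᵒᵖ} {p q : (restrictAr ι).obj n}
    (h1 : p.1.1.1 = q.1.1.1) (h2 : p.1.1.2 = q.1.1.2) (h3 : p.1.2 = q.1.2) : p = q :=
  Subtype.ext (Prod.ext (Prod.ext h1 h2) h3)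

/-- The restriction of the simplicial groupoid `G` along a map `ι` to its objects. -/
def restrict : SimplicialGroupoid.{u} where
  ob := C
  ar := restrictAr ι
  s := { app n := ↾fun p ↦ p.1.1.1 }
  t := { app n := ↾fun p ↦ p.1.1.2 }
  e :=
    { app n := ↾fun x ↦ ⟨((x, x), G.e.app n (ι.app n x)), G.s_e _, G.t_e _⟩
      naturality n m φ := by
        ext x
        · rfl
        · rfl
        · refine (congrArg (G.e.app m) (NatTrans.naturality_apply ι φ x)).trans ?_
          exact (map_e φ _).symm }
  i :=
    { app n := ↾fun p ↦ ⟨((p.1.1.2, p.1.1.1), G.i.app n p.1.2), (G.s_i _).trans p.2.2,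
        (G.t_i _).trans p.2.1⟩
      naturality n m φ := by
        ext p
        exacts [rfl, rfl, (map_i φ _).symm] }
  m :=
    { app n := ↾fun p ↦
        have h : G.t.app n p.1.1.1.2 = G.s.app n p.1.2.1.2 := by
          rw [p.1.1.2.2, p.1.2.2.1]
          exact congrArg (ι.app n) p.2
        ⟨((p.1.1.1.1.1, p.1.2.1.1.2), G.mul p.1.1.1.2 p.1.2.1.2), (s_mul h).trans p.1.1.2.1,
          (t_mul h).trans p.1.2.2.2⟩
      naturality n m φ := by
        ext p
        · rfl
        · rfl
        · refine (map_mul φ ?_).symm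
          rw [p.1.1.2.2, p.1.2.2.1]
          exact congrArg (ι.app n) p.2 }
  e_s := rfl
  e_t := rfl
  i_s := rfl
  i_t := rfl
  m_s := rfl
  m_t := rfl
  id_comp n p h := restrictAr_ext rfl rfl (e_mul p.2.1.symm)
  comp_id n p h := restrictAr_ext rfl rfl (mul_e p.2.2)
  assoc n p q r h h' h₁ h₂ := by
    refine restrictAr_ext rfl rfl (mul_assoc ?_ ?_)
    · exact p.2.2.trans ((congrArg (ι.app n) h).trans q.2.1.symm)
    · exact q.2.2.trans ((congrArg (ι.app n) h').trans r.2.1.symm)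
  inv_comp n p h := restrictAr_ext rfl rfl
    ((i_mul _).trans (congrArg (G.e.app n) p.2.2))
  comp_inv n p h := restrictAr_ext rfl rfl
    ((mul_i _).trans (congrArg (G.e.app n) p.2.1))

/-- The morphism from the restriction of `G` to `G`. -/
def restrictHom : Hom (restrict ι) G where
  ob := ι
  ar := { app n := ↾fun p ↦ p.1.2 }
  comm_s := by
    ext n p
    exact p.2.1
  comm_t := by
    ext n p
    exact p.2.2
  comm_e := rfl
  comm_m n f g h h' := mul_eq h'

variable {ι} in
lemma restrict_ext {n : SimplexCategoryᵒᵖ} {p q : (restrict ι).ar.obj n}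
    (h1 : (restrict ι).s.app n p = (restrict ι).s.app n q)
    (h2 : (restrict ι).t.app n p = (restrict ι).t.app n q)
    (h3 : (restrictHom ι).ar.app n p = (restrictHom ι).ar.app n q) : p = q :=
  restrictAr_ext h1 h2 h3

/-- An arrow of the restriction of `G`. -/
def restrictArrow {n : SimplexCategoryᵒᵖ} (x y : C.obj n) (f : G.ar.obj n)
    (hs : G.s.app n f = ι.app n x) (ht : G.t.app n f = ι.app n y) : (restrict ι).ar.obj n :=
  ⟨((x, y), f), hs, ht⟩

instance [Fibration (CartesianMonoidalCategory.lift G.s G.t)] :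
    Fibration (CartesianMonoidalCategory.lift (restrict ι).s (restrict ι).t) := by
  refine fibration_of_filler _ fun n i y b hy hb ↦ ?_
  obtain ⟨f, hf, hf'⟩ := exists_filler (CartesianMonoidalCategory.lift G.s G.t) i
    (fun j hj ↦ (restrictHom ι).ar.app _ (y j hj)) (ι.app _ b.1, ι.app _ b.2)
    (fun m φ ψ j k hj hk _ _ h ↦ hy.map (restrictHom ι).ar m φ ψ j k hj hk h) (fun j hj ↦ by
      refine Prod.ext ?_ ?_
      · refine ((restrictHom ι).s_ar _).trans ?_
        refine (congrArg (fun z ↦ ι.app _ z.1) (hb j hj)).trans ?_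
        exact NatTrans.naturality_apply ι _ _
      · refine ((restrictHom ι).t_ar _).trans ?_
        refine (congrArg (fun z ↦ ι.app _ z.2) (hb j hj)).trans ?_
        exact NatTrans.naturality_apply ι _ _)
  refine ⟨restrictArrow ι b.1 b.2 f (congrArg Prod.fst hf') (congrArg Prod.snd hf'),
    fun j hj ↦ restrict_ext ?_ ?_ (hf j hj), rfl⟩
  · exact (congrArg Prod.fst (hb j hj)).symm
  · exact (congrArg Prod.snd (hb j hj)).symm

variable {ι} in
/-- A matrix of arrows of `G` between objects in the image of `ι`, as a matrix of the
restriction. -/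
def restrictMat {n : SimplexCategoryᵒᵖ} (x : (tup C).obj n) (f : G.Mat n)
    (h : ∀ l, W.ob.app n f l = ι.app n (x l)) : (restrict ι).Mat n where
  arr j k := restrictArrow ι (x j) (x k) (f.arr j k) ((f.s_apply j k).trans (h j))
    ((f.t_apply j k).trans (h k))
  t_eq_s _ _ _ := rfl
  mul_arr j k l := by
    refine (mul_eq (G := restrict ι) rfl).trans ?_
    exact restrictAr_ext rfl rfl (f.mul_arr j k l)

lemma restrict_mat_ext {n : SimplexCategoryᵒᵖ} {f g : (restrict ι).Mat n}
    (h : ∀ l, W.ob.app n f l = W.ob.app n g l)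
    (h' : (restrictHom ι).W.app n f = (restrictHom ι).W.app n g) : f = g :=
  Mat.ext' fun i j ↦ restrict_ext (((f.s_apply i j).trans (h i)).trans (g.s_apply i j).symm)
    (((f.t_apply i j).trans (h j)).trans (g.t_apply i j).symm)
    (congrArg (fun f : G.Mat n ↦ f.arr i j) h')

instance isIso_restrictHom_endo (c : (restrict ι).ob _⦋0⦌) : IsIso ((restrictHom ι).endo c) := by
  have (n : SimplexCategoryᵒᵖ) : IsIso (((restrictHom ι).endo c).app n) := by
    refine (isIso_iff_bijective _).2 ⟨fun f g h ↦ Subtype.ext (restrict_ext ?_ ?_ ?_), fun f ↦ ?_⟩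
    · exact (s_endo f).trans (s_endo g).symm
    · exact (t_endo f).trans (t_endo g).symm
    · exact congrArg Subtype.val h
    · have h := app_degen ι c n
      exact ⟨⟨restrictArrow ι (degen c n) (degen c n) f.1 ((s_endo f).trans h.symm)
        ((t_endo f).trans h.symm), (mem_fiber_iff _ _ _).2 rfl, (mem_fiber_iff _ _ _).2 rfl⟩, rfl⟩
  exact NatIso.isIso_of_isIso_app _

end Restrict

end SimplicialGroupoid

lemma exists_filler_of_kanComplex {X : SSet.{u}} [SSet.KanComplex X] {n : ℕ} (i : Fin (n + 2))
    (y : ∀ j, j ≠ i → X _⦋n⦌) (hy : IsFaceFamily (· ≠ i) y) :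
    ∃ x : X _⦋n + 1⦌, ∀ j hj, X.δ j x = y j hj := by
  have h : Fibration (Limits.terminal.from X) := (isFibrant_iff _).1 inferInstance
  obtain ⟨x, hx, -⟩ := exists_filler (Limits.terminal.from X) i y
    (SSet.yonedaEquiv (Limits.terminal.from (Δ[n + 1] : SSet.{u})))
    (fun m φ ψ j k hj hk _ _ h ↦ hy m φ ψ j k hj hk h) (fun _ _ ↦ Subsingleton.elim _ _)
  exact ⟨x, hx⟩

namespace SimplicialGroupoid

variable {G : SimplicialGroupoid.{u}}

lemma fibration_s [SSet.KanComplex G.ob] [Fibration (CartesianMonoidalCategory.lift G.s G.t)] :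
    Fibration G.s := by
  refine fibration_of_filler _ fun n i y b hy hb ↦ ?_
  obtain ⟨z, hz⟩ := exists_filler_of_kanComplex i _ (hy.map G.t)
  obtain ⟨f, hf, hf'⟩ := exists_filler (CartesianMonoidalCategory.lift G.s G.t) i y (b, z)
    (fun m φ ψ j k hj hk _ _ h ↦ hy m φ ψ j k hj hk h)
    (fun j hj ↦ Prod.ext (hb j hj) (hz j hj).symm)
  exact ⟨f, hf, congrArg Prod.fst hf'⟩

/-! ### Conjugation of matrices -/

section Twist

variable {n m : SimplexCategoryᵒᵖ}

lemma ob_twist (h : G.Mat n) (e : (tup G.ar).obj n) (he) (l) :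
    W.ob.app n (h.twist e he) l = G.t.app n (e l) := by
  have h1 : G.t.app n (h.arr l l) = G.s.app n (e l) := by rw [h.t_apply, he]
  rw [← Mat.t_apply _ l l]
  change G.t.app n (G.mul (G.i.app n (e l)) (G.mul (h.arr l l) (e l))) = _
  rw [t_mul, t_mul h1]
  rw [t_i, he, s_mul h1, h.s_apply]

lemma map_twist (φ : n ⟶ m) (h : G.Mat n) (e : (tup G.ar).obj n) (he) (he') :
    G.W.map φ (h.twist e he) = Mat.twist (G.W.map φ h) ((tup G.ar).map φ e) he' := by
  refine Mat.ext' fun i j ↦ ?_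
  change G.ar.map φ (G.mul (G.i.app n (e _)) (G.mul (h.arr _ _) (e _))) =
    G.mul (G.i.app m (G.ar.map φ (e _))) (G.mul (G.ar.map φ (h.arr _ _)) (G.ar.map φ (e _)))
  have h1 (i j) : G.t.app n (h.arr i j) = G.s.app n (e j) := by rw [h.t_apply, he]
  rw [map_mul, map_mul _ (h1 _ _), map_i]
  rw [t_i, he, s_mul (h1 _ _), h.s_apply]

lemma twist_twist_i (f : G.Mat n) (e : (tup G.ar).obj n) (he) (he') :
    (f.twist (fun l ↦ G.i.app n (e l)) he).twist e he' = f := by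
  refine Mat.ext' fun i j ↦ ?_
  change G.mul (G.i.app n (e i)) (G.mul (G.mul (G.i.app n (G.i.app n (e i)))
    (G.mul (f.arr i j) (G.i.app n (e j)))) (e j)) = f.arr i j
  have h (l) : G.t.app n (e l) = W.ob.app n f l := by rw [← he, s_i]
  have h1 : G.t.app n (f.arr i j) = G.s.app n (G.i.app n (e j)) := by rw [he, f.t_apply]
  have h2 : G.t.app n (e i) = G.s.app n (G.mul (f.arr i j) (G.i.app n (e j))) := by
    rw [s_mul h1, f.s_apply, h]
  have h3 : G.t.app n (G.mul (f.arr i j) (G.i.app n (e j))) = G.s.app n (e j) := by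
    rw [t_mul h1, t_i]
  rw [i_i, mul_assoc h2 h3, i_mul_mul, mul_assoc h1 (G.t_i _), i_mul, mul_e]
  · rw [f.t_apply, h]
  · rw [h2, s_mul h1, s_mul h3, s_mul h1]

lemma twist_i_twist (h : G.Mat n) (e : (tup G.ar).obj n) (he) (he') :
    (h.twist e he).twist (fun l ↦ G.i.app n (e l)) he' = h := by
  have h1 : h.twist e he = h.twist (fun l ↦ G.i.app n (G.i.app n (e l))) (fun l ↦ by
      rw [i_i]; exact he l) :=
    Mat.ext' fun i j ↦ by
      change G.mul _ (G.mul _ _) = G.mul (G.i.app n (G.i.app n (G.i.app n (e i))))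
        (G.mul _ (G.i.app n (G.i.app n (e j))))
      rw [i_i, i_i]
  simp only [h1]
  exact twist_twist_i h (fun l ↦ G.i.app n (e l)) _ _

lemma twist_congr {h h' : G.Mat n} {e e' : (tup G.ar).obj n} (hh : h = h') (hee : e = e')
    (he) (he') : h.twist e he = h'.twist e' he' := by
  subst hh hee
  rfl

lemma twist_e (h : G.Mat n) (he) :
    h.twist (fun l ↦ G.e.app n (W.ob.app n h l)) he = h := by
  refine Mat.ext' fun i j ↦ ?_
  change G.mul (G.i.app n (G.e.app n _)) (G.mul (h.arr i j) (G.e.app n _)) = h.arr i j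
  rw [i_e, mul_e (h.t_apply i j), e_mul (h.s_apply i j).symm]

end Twist

/-! ### Restriction to enough objects is a weak equivalence on classifying spaces -/

section Restrict

variable {C : SSet.{u}} (ι : C ⟶ G.ob)

/-- The target of an arrow whose source is in the image of `ι`. -/
def outTarget : fiberProd ι G.s ⟶ G.ob := fiberProd.snd ι G.s ≫ G.t

instance [SSet.KanComplex C] [Fibration (CartesianMonoidalCategory.lift G.s G.t)] :
    Fibration (outTarget ι) := by
  refine fibration_of_filler _ fun n i y b hy hb ↦ ?_
  obtain ⟨x, hx⟩ := exists_filler_of_kanComplex i _ (hy.map (fiberProd.fst ι G.s))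
  obtain ⟨f, hf, hf'⟩ := exists_filler (CartesianMonoidalCategory.lift G.s G.t) i
    (fun j hj ↦ (y j hj).1.2) (ι.app _ x, b)
    (fun m φ ψ j k hj hk _ _ h ↦ hy.map (fiberProd.snd ι G.s) m φ ψ j k hj hk h) (fun j hj ↦ by
      refine Prod.ext ?_ (hb j hj)
      refine (y j hj).2.symm.trans ?_
      refine (congrArg (ι.app _) (hx j hj)).symm.trans ?_
      exact NatTrans.naturality_apply ι _ _)
  exact ⟨⟨(x, f), (congrArg Prod.fst hf').symm⟩,
    fun j hj ↦ Subtype.ext (Prod.ext (hx j hj) (hf j hj)), congrArg Prod.snd hf'⟩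

lemma exists_outTarget_eq (hι : ∀ b : G.ob _⦋0⦌, ∃ x, ι.app _ x = b) (b : G.ob _⦋0⦌) :
    ∃ x, (outTarget ι).app _ x = b := by
  obtain ⟨x, hx⟩ := hι b
  exact ⟨⟨(x, G.e.app _ b), hx.trans (G.s_e b).symm⟩, G.t_e b⟩

/-- The matrices of arrows of the restriction of `G` along `ι`, together with an arrow of `G` from
each of their objects. -/
abbrev extMat : SSet.{u} := fiberProd (W.ob (G := restrict ι)) (tupMap (fiberProd.fst ι G.s))

variable {ι} in
lemma extMat_s {n : SimplexCategoryᵒᵖ} (h : (extMat ι).obj n) (l) :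
    G.s.app n (h.1.2 l).1.2 = W.ob.app n ((restrictHom ι).W.app n h.1.1) l :=
  (h.1.2 l).2.symm.trans ((congrArg (fun z : (tup C).obj n ↦ ι.app n (z l)) h.2).symm.trans
    ((restrictHom ι).s_ar _).symm)

/-- Conjugation of a matrix of the restriction with the given arrows. -/
def extMat.twist : extMat ι ⟶ G.W where
  app n := ↾fun h ↦ Mat.twist ((restrictHom ι).W.app n h.1.1) (fun l ↦ (h.1.2 l).1.2) (extMat_s h)
  naturality n m φ := by
    ext h
    exact (map_twist φ ((restrictHom ι).W.app n h.1.1) (fun l ↦ (h.1.2 l).1.2) (extMat_s h)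
      (extMat_s ((extMat ι).map φ h))).symm

/-- A tuple of arrows that end at the objects of a matrix of `G` and start in the image of `ι`
determines the matrix of the restriction of `G` that is conjugated to the given one, and such tuples
of arrows can be extended by `trivFib_tupMap`. -/
lemma trivFib_extMat_twist [SSet.KanComplex C]
    [Fibration (CartesianMonoidalCategory.lift G.s G.t)]
    (hι : ∀ b : G.ob _⦋0⦌, ∃ x, ι.app _ x = b) : TrivFib (extMat.twist ι) := by
  refine trivFib_of_subcomplex _ fun B A f g w ↦ ?_
  have hT := trivFib_tupMap (outTarget ι) (exists_outTarget_eq ι hι) A.ι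
    (by rw [MorphismProperty.monomorphisms.iff]; infer_instance)
  have hw {n} (a : (A : SSet.{u}).obj n) :
    Mat.twist ((restrictHom ι).W.app n (f.app n a).1.1) (fun l ↦ ((f.app n a).1.2 l).1.2)
      (extMat_s (f.app n a)) = g.app n a.1 := ConcreteCategory.congr_hom (congr_app w n) a
  have sq : CommSq (f ≫ fiberProd.snd _ _) A.ι (tupMap (outTarget ι)) (g ≫ W.ob) := ⟨by
    ext n a l
    refine Eq.trans ?_ (congrArg (fun z ↦ W.ob.app n z l) (hw a))
    exact (ob_twist ((restrictHom ι).W.app n (f.app n a).1.1) (fun l ↦ ((f.app n a).1.2 l).1.2)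
      (extMat_s _) l).symm⟩
  have hl {n} (b : B.obj n) (l) : G.t.app n (sq.lift.app n b l).1.2 = W.ob.app n (g.app n b) l :=
    congr_fun (ConcreteCategory.congr_hom (congr_app sq.fac_right n) b) l
  have hl' {n} (a : (A : SSet.{u}).obj n) : sq.lift.app n a.1 = (f.app n a).1.2 :=
    ConcreteCategory.congr_hom (congr_app sq.fac_left n) a
  -- the matrix of `G` obtained by conjugation with the inverses of the arrows that have been found
  let q {n} (b : B.obj n) : G.Mat n := (g.app n b).twist
    (fun l ↦ G.i.app n (sq.lift.app n b l).1.2) (fun l ↦ (G.s_i _).trans (hl b l))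
  have hq {n} (b : B.obj n) (l) : W.ob.app n (q b) l = ι.app n (sq.lift.app n b l).1.1 := by
    refine (ob_twist _ _ _ l).trans ((G.t_i _).trans ?_)
    exact (sq.lift.app n b l).2.symm
  let L : B ⟶ extMat ι :=
    { app n := ↾fun b ↦ ⟨(restrictMat (fun l ↦ (sq.lift.app n b l).1.1) (q b) (hq b),
        sq.lift.app n b), rfl⟩
      naturality n m φ := by
        ext b
        have h1 : sq.lift.app m (B.map φ b) = (tup (fiberProd ι G.s)).map φ (sq.lift.app n b) :=
          NatTrans.naturality_apply sq.lift φ b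
        refine Subtype.ext (Prod.ext (restrict_mat_ext ι (fun l ↦ ?_) ?_) h1)
        · exact congrArg (fun z : (tup (fiberProd ι G.s)).obj m ↦ (z l).1.1) h1
        · refine (twist_congr (NatTrans.naturality_apply g φ b) (funext fun l ↦ ?_)
            (fun l ↦ (G.s_i _).trans (hl (B.map φ b) l)) (fun l ↦ (s_map φ _).trans ?_)).trans
            (map_twist φ (g.app n b)
              (fun l ↦ G.i.app n (sq.lift.app n b l).1.2)
              (fun l ↦ (G.s_i _).trans (hl b l)) _).symm
          · refine (congrArg (fun z : (tup (fiberProd ι G.s)).obj m ↦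
              G.i.app m (z l).1.2) h1).trans ?_
            exact (map_i φ _).symm
          · refine (congrArg (G.ob.map φ) ((G.s_i _).trans (hl b _))).trans ?_
            exact congr_fun (NatTrans.naturality_apply W.ob φ (g.app n b)) l |>.symm }
  refine ⟨L, ?_, ?_⟩
  · ext n a
    refine Subtype.ext (Prod.ext (restrict_mat_ext ι (fun l ↦ ?_) ?_) (hl' a))
    · refine (congrArg (fun z : (tup (fiberProd ι G.s)).obj n ↦ (z l).1.1) (hl' a)).trans ?_
      exact (congr_fun (f.app n a).2 l).symm
    · refine (twist_congr (hw a).symm (funext fun l ↦ ?_)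
        (fun l ↦ (G.s_i _).trans (hl a.1 l))
        (fun l ↦ (G.s_i _).trans (ob_twist _ _ _ l).symm)).trans
        (twist_i_twist _ (fun l ↦ ((f.app n a).1.2 l).1.2) (extMat_s _) _)
      exact congrArg (fun z : (tup (fiberProd ι G.s)).obj n ↦ G.i.app n (z l).1.2) (hl' a)
  · ext n b
    exact twist_twist_i (g.app n b) (fun l ↦ (sq.lift.app n b l).1.2)
      (fun l ↦ (G.s_i _).trans (hl b l)) (extMat_s (L.app n b))

end Restrict


section Restrict

variable {C : SSet.{u}} (ι : C ⟶ G.ob)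

/-- The section of `extMat ι ⟶ W (restrict ι)` given by identity arrows. -/
def extMat.unit : (restrict ι).W ⟶ extMat ι where
  app n := ↾fun h ↦ ⟨(h, fun l ↦ ⟨(W.ob.app n h l, G.e.app n (ι.app n (W.ob.app n h l))),
    (G.s_e _).symm⟩), rfl⟩
  naturality n m φ := by
    ext h
    refine Subtype.ext (Prod.ext rfl (funext fun l ↦ Subtype.ext (Prod.ext ?_ ?_)))
    · exact congr_fun (NatTrans.naturality_apply W.ob φ h) l
    · refine Eq.trans ?_ (map_e φ _).symm
      refine congrArg (G.e.app m) ?_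
      refine Eq.trans ?_ (NatTrans.naturality_apply ι φ _)
      exact congrArg (ι.app m) (congr_fun (NatTrans.naturality_apply W.ob φ h) l)

lemma extMat.unit_twist : extMat.unit ι ≫ extMat.twist ι = (restrictHom ι).W := by
  ext n h
  refine (twist_congr rfl (funext fun l ↦ ?_) (extMat_s ((extMat.unit ι).app n h))
    fun l ↦ G.s_e _).trans (twist_e _ fun l ↦ G.s_e _)
  exact congrArg (G.e.app n) ((restrictHom ι).s_ar _).symm

/-- The contraction of the arrows of a simplex of `extMat ι` to identity arrows. -/
def extMat.contract : Δ[1] ⊗ extMat ι ⟶ extMat ι where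
  app n := ↾fun p ↦ ⟨(p.2.1.1, fun l ↦
    if val p.1 l = 0 then p.2.1.2 l else ((extMat.unit ι).app n p.2.1.1).1.2 l), by
      refine p.2.2.trans ?_
      funext l
      change (p.2.1.2 l).1.1 = (ite _ _ _ : (fiberProd ι G.s).obj n).1.1
      split_ifs
      · rfl
      · exact (congr_fun p.2.2 l).symm⟩
  naturality n m φ := by
    ext p
    refine Subtype.ext (Prod.ext rfl (funext fun l ↦ ?_))
    have h := congrArg (fun z : (extMat ι).obj m ↦ z.1.2 l)
      (NatTrans.naturality_apply (extMat.unit ι) φ p.2.1.1)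
    refine Eq.trans ?_ (apply_ite ((fiberProd ι G.s).map φ)
      (val p.1 (φ.unop.toOrderHom l) = 0) _ _).symm
    refine Eq.trans ?_ (congrArg (fun y ↦ if val p.1 (φ.unop.toOrderHom l) = 0 then
      (fiberProd ι G.s).map φ (p.2.1.2 (φ.unop.toOrderHom l)) else y) h)
    rfl

lemma isWeakEquiv_extMat_unit : IsWeakEquiv (extMat.unit ι) := by
  refine (isWeakEquiv_of_section (f := fiberProd.fst _ _) (s := extMat.unit ι) rfl
    (extMat.contract ι) (v := 1) (w := 0) ?_ ?_).2
  · ext n h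
    rfl
  · ext n h
    rfl

lemma isWeakEquiv_restrictHom_W [SSet.KanComplex C]
    [Fibration (CartesianMonoidalCategory.lift G.s G.t)]
    (hι : ∀ b : G.ob _⦋0⦌, ∃ x, ι.app _ x = b) : IsWeakEquiv (restrictHom ι).W := by
  rw [← extMat.unit_twist]
  exact (isWeakEquiv_extMat_unit ι).comp (trivFib_extMat_twist ι hι).isWeakEquiv

lemma isWeakEquiv_restrictHom_B [SSet.KanComplex C]
    [Fibration (CartesianMonoidalCategory.lift G.s G.t)]
    (hι : ∀ b : G.ob _⦋0⦌, ∃ x, ι.app _ x = b) : IsWeakEquiv (restrictHom ι).B := by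
  refine (isWeakEquiv_of_isIso G.toW).of_comp_right ?_
  rw [Hom.B_toW]
  exact (isWeakEquiv_of_isIso _).comp (isWeakEquiv_restrictHom_W ι hι)

/-- The classifying space of `G` also maps to that of its restriction by a weak equivalence. -/
lemma exists_isWeakEquiv_B_restrict [SSet.KanComplex C]
    [Fibration (CartesianMonoidalCategory.lift G.s G.t)]
    (hι : ∀ b : G.ob _⦋0⦌, ∃ x, ι.app _ x = b) :
    ∃ j : G.B ⟶ (restrict ι).B, IsWeakEquiv j := by
  have hT := trivFib_extMat_twist ι hι
  obtain ⟨σ, hσ⟩ := hT.exists_section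
  refine ⟨G.toW ≫ σ ≫ fiberProd.fst _ _ ≫ inv (restrict ι).toW,
    (isWeakEquiv_of_isIso _).comp (.comp ?_ (.comp ?_ (isWeakEquiv_of_isIso _)))⟩
  · refine hT.isWeakEquiv.of_comp_right ?_
    rw [hσ]
    exact .id _
  · refine (isWeakEquiv_extMat_unit ι).of_comp_left ?_
    exact .id _

end Restrict

/-! ### Naturality of the comparison map -/

section Naturality

variable {G' : SimplicialGroupoid.{u}} (F : Hom G G')

lemma arrow_functor {n : SimplexCategoryᵒᵖ} (f : G.ar.obj n) :
    G'.arrow (F.ar.app n f) = G.arrow f ⋙ F.functor n := by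
  refine ComposableArrows.ext₁ ?_ ?_ ?_
  · exact F.s_ar f
  · exact F.t_ar f
  · refine Subtype.ext ?_
    exact (G'.eqToHom_comp_val (n := n) _ ((F.functor n).map
      (X := (G.s.app n f : G.Obj n)) (Y := (G.t.app n f : G.Obj n)) ⟨f, rfl, rfl⟩) _).symm

lemma arrowPath_B : G.arrowPath ≫ F.B = Δ[1] ◁ F.ar ≫ G'.arrowPath := by
  ext n ⟨α, f⟩
  change _ = (nerve (G'.Obj n)).map (SSet.stdSimplex.objEquiv α).op (G'.arrow (F.ar.app n f))
  rw [arrow_functor]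
  rfl

lemma toLoopSpace_naturality (c : G.ob _⦋0⦌) :
    G.toLoopSpace c ≫ loopSpaceMap F.B (G.vertex c) _ (F.B_vertex c) =
      F.endo c ≫ G'.toLoopSpace (F.ob.app _ c) := by
  rw [← cancel_mono (Subfunctor.ι _), Category.assoc, loopSpaceMap_ι]
  change ((G.endo c).ι ≫ MonoidalClosed.curry G.arrowPath) ≫ (ihom Δ[1]).map F.B =
    ((G.endo c).ι ≫ F.ar) ≫ MonoidalClosed.curry G'.arrowPath
  rw [Category.assoc, ← MonoidalClosed.curry_natural_right, arrowPath_B,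
    MonoidalClosed.curry_natural_left, Category.assoc]

end Naturality

/-! ### The comparison map is a weak equivalence -/

section Discrete

/-- The discrete simplicial set on a type. -/
@[simps]
def discrete (S : Type u) : SSet.{u} where
  obj _ := S
  map _ := 𝟙 S

instance (S : Type u) : SSet.KanComplex (discrete S) := by
  refine kanComplex_of_filler fun n i y hy ↦ ?_
  obtain ⟨j, hj⟩ := exists_ne i
  refine ⟨y j hj, fun k hk ↦ ?_⟩
  -- all faces of the horn contain the vertex `i`
  obtain ⟨q, hq⟩ := Fin.exists_succAbove_eq hj.symm
  obtain ⟨r, hr⟩ := Fin.exists_succAbove_eq hk.symm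
  refine hy 0 (SimplexCategory.const _ _ q) (SimplexCategory.const _ _ r) j k hj hk ?_
  ext l
  exact congrArg Fin.val (hq.trans hr.symm)

variable (G) in
/-- The inclusion of the discrete simplicial set of the vertices of `ob(G)`. -/
def vertexInclusion : discrete (G.ob _⦋0⦌) ⟶ G.ob where
  app n := ↾fun x ↦ degen x n
  naturality n m φ := by
    ext x
    exact (map_degen x φ).symm

lemma exists_vertexInclusion_eq (b : G.ob _⦋0⦌) : ∃ x, (vertexInclusion G).app _ x = b :=
  ⟨b, degen_zero b⟩

variable [Fibration (CartesianMonoidalCategory.lift G.s G.t)]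

instance : SSet.KanComplex (restrict (vertexInclusion G)).ob :=
  inferInstanceAs (SSet.KanComplex (discrete _))

instance : SSet.KanComplex (restrict (vertexInclusion G)).B :=
  have := fibration_s (G := restrict (vertexInclusion G))
  kanComplex_B

/-- The case of a general `ob(G)` follows from that of a discrete one, by restriction of `G` to the
vertices of `ob(G)`. -/
theorem isWeakEquiv_toLoopSpace_comp (c : G.ob _⦋0⦌) {K : SSet.{u}} [SSet.KanComplex K]
    (j : G.B ⟶ K) (hj : IsWeakEquiv j) :
    IsWeakEquiv (G.toLoopSpace c ≫ loopSpaceMap j (G.vertex c) _ rfl) := by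
  let F := restrictHom (vertexInclusion G)
  suffices h : ∀ (d : (restrict (vertexInclusion G)).ob _⦋0⦌) (c' : G.ob _⦋0⦌),
      F.ob.app _ d = c' →
        IsWeakEquiv (G.toLoopSpace c' ≫ loopSpaceMap j (G.vertex c') _ rfl) from
    h c c (degen_zero c)
  rintro d _ rfl
  have hF : IsWeakEquiv (F.B ≫ j) :=
    (isWeakEquiv_restrictHom_B _ exists_vertexInclusion_eq).comp hj
  have h := (isWeakEquiv_toLoopSpace_of_kanComplex_ob (G := restrict (vertexInclusion G)) d).comp
    (hF.isLoopEquiv _ _ (congrArg (j.app _) (F.B_vertex d)))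
  rw [← loopSpaceMap_comp F.B j _ _ _ (F.B_vertex d) rfl, ← Category.assoc,
    toLoopSpace_naturality, Category.assoc] at h
  have : IsIso (F.endo d) := isIso_restrictHom_endo _ d
  exact (isWeakEquiv_of_isIso (F.endo d)).of_comp_left h

end Discrete

end SimplicialGroupoid

end SimplicialGroupoids

end

theorem mainTheorem2 :
    -- (i)
    (∀ G : SimplicialGroupoid.{u}, SSet.KanComplex G.ob → Fibration G.s →
      SSet.KanComplex G.B) ∧
    -- (ii)
    (∀ (G : SimplicialGroupoid.{u}) (X : SSet.{u}) (π : X ⟶ G.ob)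
      (A : SimplicialGroupoid.LeftAction G π),
      Fibration π → Fibration A.proj.B) ∧
    -- (iii)
    (∀ G : SimplicialGroupoid.{u},
      (∀ n : SimplexCategoryᵒᵖ, Function.Surjective
        ((CartesianMonoidalCategory.lift G.s G.t : G.ar ⟶ G.ob ⊗ G.ob).app n)) →
      Fibration (CartesianMonoidalCategory.lift G.s G.t)) ∧
    -- (iv), the weak equivalence
    (∀ G : SimplicialGroupoid.{u}, Fibration (CartesianMonoidalCategory.lift G.s G.t) →
      ∀ c : G.ob _⦋0⦌,
        (SSet.KanComplex G.B → IsWeakEquiv (G.toLoopSpace c)) ∧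
        (∀ (K : SSet.{u}) (j : G.B ⟶ K), SSet.KanComplex K → IsWeakEquiv j →
          IsWeakEquiv (G.toLoopSpace c ≫
            loopSpaceMap j (G.vertex c) (j.app _ (G.vertex c)) rfl)) ∧
        (∃ (K : SSet.{u}) (j : G.B ⟶ K), SSet.KanComplex K ∧ IsWeakEquiv j)) ∧
    -- (iv), naturality
    (∀ (G G' : SimplicialGroupoid.{u}) (F : SimplicialGroupoid.Hom G G') (c : G.ob _⦋0⦌)
      (K K' : SSet.{u}) (j : G.B ⟶ K) (j' : G'.B ⟶ K') (k : K ⟶ K')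
      (_ : j ≫ k = F.B ≫ j')
      (h : k.app _ (j.app _ (G.vertex c)) = j'.app _ (G'.vertex (F.ob.app _ c))),
      (G.toLoopSpace c ≫ loopSpaceMap j (G.vertex c) _ rfl) ≫ loopSpaceMap k _ _ h =
        F.endo c ≫ G'.toLoopSpace (F.ob.app _ c) ≫
          loopSpaceMap j' (G'.vertex (F.ob.app _ c)) _ rfl) := by
  refine ⟨fun G _ _ ↦ SimplicialGroupoid.kanComplex_B,
    fun G X π A _ ↦ SimplicialGroupoid.fibration_proj_B A,
    fun G hG ↦ SimplicialGroupoid.fibration_lift_s_t fun n x x' ↦ ?_,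
    fun G _ c ↦ ⟨fun _ ↦ ?_, fun K j _ hj ↦ G.isWeakEquiv_toLoopSpace_comp c j hj, ?_⟩,
    fun G G' F c K K' j j' k w h ↦ ?_⟩
  · obtain ⟨f, hf⟩ := hG n (x, x')
    exact ⟨f, congrArg Prod.fst hf, congrArg Prod.snd hf⟩
  · have := G.isWeakEquiv_toLoopSpace_comp c (𝟙 G.B) (.id _)
    have e : loopSpaceMap (𝟙 G.B) (G.vertex c) _ rfl = 𝟙 _ := loopSpaceMap_id _
    exact (congrArg (fun f ↦ IsWeakEquiv (G.toLoopSpace c ≫ f)) e).mp this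
  · obtain ⟨j, hj⟩ := SimplicialGroupoid.exists_isWeakEquiv_B_restrict G.vertexInclusion
      SimplicialGroupoid.exists_vertexInclusion_eq
    exact ⟨_, j, inferInstance, hj⟩
  · rw [← Category.assoc (F.endo c), ← SimplicialGroupoid.toLoopSpace_naturality, Category.assoc,
      Category.assoc, loopSpaceMap_comp, loopSpaceMap_comp]
    congr 1
    rw [← cancel_mono (Subfunctor.ι _)]
    exact congrArg (fun f ↦ (loopSpace G.B (G.vertex c)).ι ≫ (ihom Δ[1]).map f) w
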